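/- Let $k$ be a field of characteristic $0$ and let $O$ be an operad in $k$-vector spaces (symmetric, possibly coloured, with operations in degree $0$). A dgOa is a differential graded algebra over $O$: for every colour a $\mathbb Z$-graded $k$-vector space with a differential $d$ of degree $-1$, on which $O$ acts by multilinear maps of degree $0$, compatibly with identities, composition and (with Koszul signs) permutation of the inputs, so that $d$ is a graded derivation of all the operations. A map of dgOa's is a degree $0$ linear map (in every colour) commuting with the operations and the differentials. A dgOa $T$ is free triangular if, after forgetting $d$, it is the free graded $O$-algebra on some family of homogeneous generators, and these generators carry a partial order in which all descending chains are finite, such that the differential of any generator is a sum of $O$-operations applied to strictly smaller generators. Two maps $f,g\colon T\to A$ of dgOa's are homotopic if there is a map of dgOa's $H\colon T\to A\otimes k[t,dt]$, where $k[t,dt]$ is the commutative dg algebra of polynomial differential forms on the line, whose evaluations at $t=0$ and $t=1$ (with $dt=0$) are $f$ and $g$ respectively. Let $T$ be a free triangular dgOa, let $f\colon T\to A$ be a map into an arbitrary dgOa $A$, and let $p\colon B\to A$ be any map of dgOa's inducing an isomorphism on homology. Then there is a map of dgOa's $g\colon T\to B$ such that $p\circ g$ is homotopic to $f$, and any two maps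 $g,g'\colon T\to B$ such that $p\circ g$ and $p\circ g'$ are both homotopic to $f$ are homotopic to each other. -/

import Mathlib

universe u

/-- A (symmetric, coloured) operad in `k`-vector spaces with set of colours `C`, in
coordinate-free form: the inputs of an operation are labelled by a finite type `I` rather than by
`{1, …, n}`.  `Op a c` is the space of operations whose input labelled `i : I` has colour `a i` and
whose output has colour `c`.  Ordinary one-coloured operads are the case where `C` is a point. -/
structure ColoredOperad (k : Type u) [Field k] (C : Type u) where
  /-- the space of operations -/
  Op : {I : Type} → [Finite I] → (I → C) → C → Type u
  [addCommGroup : ∀ {I : Type} [Finite I] (a : I → C) (c : C), AddCommGroup (Op a c)]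
  [module : ∀ {I : Type} [Finite I] (a : I → C) (c : C), Module k (Op a c)]
  /-- relabelling of the inputs along a bijection (the symmetric group actions) -/
  relabel : ∀ {I J : Type} [Finite I] [Finite J] (e : I ≃ J) (a : J → C) {c : C},
    Op (fun i => a (e i)) c →ₗ[k] Op a c
  /-- the identity operations -/
  one : ∀ c : C, Op (fun _ : Unit => c) c
  /-- operadic composition: plug `p i` into the input `i` of `o`, for all `i` simultaneously -/
  comp : ∀ {I : Type} [Finite I] {J : I → Type} [∀ i, Finite (J i)] {b : ∀ i, J i → C}
    {a : I → C} {c : C}, Op a c →ₗ[k]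
      MultilinearMap k (fun i => Op (b i) (a i)) (Op (fun q : Σ i, J i => b q.1 q.2) c)
  relabel_refl : ∀ {I : Type} [Finite I] (a : I → C) {c : C} (o : Op a c),
    relabel (Equiv.refl I) a o = o
  relabel_trans : ∀ {I J K : Type} [Finite I] [Finite J] [Finite K] (e : I ≃ J) (f : J ≃ K)
    (a : K → C) {c : C} (o : Op (fun i => a (f (e i))) c),
    relabel (e.trans f) a o = relabel f a (relabel e (fun j => a (f j)) o)
  /-- equivariance of composition in the outer operation -/
  comp_relabel_left : ∀ {I I' : Type} [Finite I] [Finite I'] (e : I ≃ I') {J : I' → Type}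
    [∀ i, Finite (J i)] {b : ∀ i, J i → C} {a : I' → C} {c : C} (o : Op (fun i => a (e i)) c)
    (p : ∀ i, Op (b i) (a i)),
    comp (relabel e a o) p =
      relabel (Equiv.sigmaCongrLeft e : (Σ i, J (e i)) ≃ Σ i', J i') (fun q => b q.1 q.2)
        (comp o (fun i => p (e i)))
  /-- equivariance of composition in the inner operations -/
  comp_relabel_right : ∀ {I : Type} [Finite I] {J J' : I → Type} [∀ i, Finite (J i)]
    [∀ i, Finite (J' i)] (e : ∀ i, J i ≃ J' i) {b : ∀ i, J' i → C} {a : I → C} {c : C}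
    (o : Op a c) (p : ∀ i, Op (fun j => b i (e i j)) (a i)),
    comp o (fun i => relabel (e i) (b i) (p i)) =
      relabel (Equiv.sigmaCongrRight e) (fun q => b q.1 q.2) (comp o p)
  comp_assoc : ∀ {I : Type} [Finite I] {J : I → Type} [∀ i, Finite (J i)]
    {K : ∀ i, J i → Type} [∀ i j, Finite (K i j)] {z : ∀ i j, K i j → C} {b : ∀ i, J i → C}
    {a : I → C} {c : C} (o : Op a c) (p : ∀ i, Op (b i) (a i)) (q : ∀ i j, Op (z i j) (b i j)),
    relabel (Equiv.sigmaAssoc K) (fun t => z t.1 t.2.1 t.2.2)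
        (comp (comp o p) (fun s : Σ i, J i => q s.1 s.2)) =
      comp o (fun i => comp (p i) (q i))
  one_comp : ∀ {I : Type} [Finite I] {a : I → C} {c : C} (o : Op a c),
    relabel (Equiv.uniqueSigma (fun _ : Unit => I)) a (comp (one c) (fun _ => o)) = o
  comp_one : ∀ {I : Type} [Finite I] {a : I → C} {c : C} (o : Op a c),
    relabel (Equiv.sigmaUnique I (fun _ => Unit)) a (comp o (fun i => one (a i))) = o

attribute [instance] ColoredOperad.addCommGroup ColoredOperad.module

/-- The Koszul sign of reordering a tensor product of homogeneous elements of degrees `n j` from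
the order of `J` to the order of `I` along the bijection `e`: a factor `(-1) ^ (|x| |y|)` for every
pair of elements `x`, `y` whose order is reversed. -/
def koszulSign (k : Type*) [Field k] {I J : Type} [Fintype I] [LinearOrder I] [LinearOrder J]
    (e : I ≃ J) (n : J → ℤ) : k :=
  ∏ i : I, ∏ i' : I, if i < i' ∧ e i' < e i then (-1 : k) ^ (n (e i) * n (e i')) else 1

/-- The lexicographic order on `Σ i, J i`. -/
@[reducible] def sigmaLexOrder {I : Type} [LinearOrder I] (J : I → Type) [∀ i, LinearOrder (J i)] :
    LinearOrder (Σ i, J i) :=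
  inferInstanceAs (LinearOrder (Σₗ i, J i))

/-- A graded algebra over the operad `O` (whose operations have degree `0`): for every colour a
`ℤ`-graded vector space, with an action of `O` by multilinear maps of degree `0` that is compatible
with identities, composition and (with the Koszul sign rule) relabelling of inputs.  The inputs of
an acting operation are linearly ordered, since signs depend on the order of the tensor factors. -/
structure GradedOAlgebra {k : Type u} [Field k] {C : Type u} (O : ColoredOperad k C) where
  carrier : C → Type u
  [addCommGroup : ∀ c, AddCommGroup (carrier c)]
  [module : ∀ c, Module k (carrier c)]
  /-- the homogeneous elements of each degree -/
  gr : ∀ c, ℤ → Submodule k (carrier c)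
  isInternal : ∀ c, DirectSum.IsInternal (gr c)
  /-- the action of operations -/
  act : ∀ {I : Type} [Fintype I] [LinearOrder I] {a : I → C} {c : C},
    O.Op a c →ₗ[k] MultilinearMap k (fun i => carrier (a i)) (carrier c)
  act_mem : ∀ {I : Type} [Fintype I] [LinearOrder I] {a : I → C} {c : C} (o : O.Op a c)
    (n : I → ℤ) (x : ∀ i, carrier (a i)), (∀ i, x i ∈ gr (a i) (n i)) →
    act o x ∈ gr c (∑ i, n i)
  act_one : ∀ (c : C) (x : Unit → carrier c), act (O.one c) x = x ()
  /-- compatibility with composition; the inputs of a composite are ordered lexicographically -/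
  act_comp : ∀ {I : Type} [Fintype I] [LinearOrder I] {J : I → Type} [∀ i, Fintype (J i)]
    [∀ i, LinearOrder (J i)] {b : ∀ i, J i → C} {a : I → C} {c : C} (o : O.Op a c)
    (p : ∀ i, O.Op (b i) (a i)) (x : ∀ q : Σ i, J i, carrier (b q.1 q.2)),
    @act (Σ i, J i) _ (sigmaLexOrder J) (fun q => b q.1 q.2) c (O.comp o p) x =
      act o (fun i => act (p i) (fun j => x ⟨i, j⟩))
  act_relabel : ∀ {I J : Type} [Fintype I] [LinearOrder I] [Fintype J] [LinearOrder J]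
    (e : I ≃ J) {a : J → C} {c : C} (o : O.Op (fun i => a (e i)) c) (n : J → ℤ)
    (x : ∀ j, carrier (a j)), (∀ j, x j ∈ gr (a j) (n j)) →
    act (O.relabel e a o) x = koszulSign k e n • act o (fun i => x (e i))

attribute [instance] GradedOAlgebra.addCommGroup GradedOAlgebra.module

/-- A differential graded algebra over the operad `O`: a graded algebra over `O` with a
differential of degree `-1` that is a (signed) derivation of all operations. -/
structure DGOAlgebra {k : Type u} [Field k] {C : Type u} (O : ColoredOperad k C) extends
    GradedOAlgebra O where
  d : ∀ c, carrier c →ₗ[k] carrier c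
  d_mem : ∀ (c : C) (n : ℤ) (x : carrier c), x ∈ gr c n → d c x ∈ gr c (n - 1)
  d_d : ∀ (c : C) (x : carrier c), d c (d c x) = 0
  d_act : ∀ {I : Type} [Fintype I] [LinearOrder I] {a : I → C} {c : C} (o : O.Op a c)
    (n : I → ℤ) (x : ∀ i, carrier (a i)), (∀ i, x i ∈ gr (a i) (n i)) →
    d c (act o x) = ∑ i, (-1 : k) ^ (∑ j with j < i, n j) •
      act o (Function.update x i (d (a i) (x i)))

/-- Degree `0` maps of graded algebras over `O`. -/
structure GradedOHom {k : Type u} [Field k] {C : Type u} {O : ColoredOperad k C}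
    (A B : GradedOAlgebra O) where
  toFun : ∀ c, A.carrier c →ₗ[k] B.carrier c
  map_gr : ∀ (c : C) (n : ℤ) (x : A.carrier c), x ∈ A.gr c n → toFun c x ∈ B.gr c n
  map_act : ∀ {I : Type} [Fintype I] [LinearOrder I] {a : I → C} {c : C} (o : O.Op a c)
    (x : ∀ i, A.carrier (a i)), toFun c (A.act o x) = B.act o (fun i => toFun (a i) (x i))

/-- Maps of dg algebras over `O`. -/
structure DGOHom {k : Type u} [Field k] {C : Type u} {O : ColoredOperad k C}
    (A B : DGOAlgebra O) extends GradedOHom A.toGradedOAlgebra B.toGradedOAlgebra where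
  map_d : ∀ (c : C) (x : A.carrier c), toFun c (A.d c x) = B.d c (toFun c x)

/-- Composition of maps of dg algebras over `O` (first `f`, then `g`). -/
def DGOHom.comp {k : Type u} [Field k] {C : Type u} {O : ColoredOperad k C}
    {A B D : DGOAlgebra O} (g : DGOHom B D) (f : DGOHom A B) : DGOHom A D where
  toFun c := g.toFun c ∘ₗ f.toFun c
  map_gr c n x hx := g.map_gr c n _ (f.map_gr c n x hx)
  map_act o x := by simp [f.map_act, g.map_act]
  map_d c x := by simp [f.map_d, g.map_d]

/-- The (total) homology, cycles modulo boundaries, in colour `c`. -/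
abbrev DGOAlgebra.homology {k : Type u} [Field k] {C : Type u} {O : ColoredOperad k C}
    (A : DGOAlgebra O) (c : C) : Type u :=
  LinearMap.ker (A.d c) ⧸ (LinearMap.range (A.d c)).submoduleOf (LinearMap.ker (A.d c))

/-- The map induced on homology. -/
def DGOHom.homologyMap {k : Type u} [Field k] {C : Type u} {O : ColoredOperad k C}
    {A B : DGOAlgebra O} (f : DGOHom A B) (c : C) : A.homology c →ₗ[k] B.homology c :=
  Submodule.mapQ _ _
    ((f.toFun c).restrict (p := LinearMap.ker (A.d c)) (q := LinearMap.ker (B.d c))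
      (fun x hx => by
        rw [LinearMap.mem_ker] at hx ⊢
        rw [← f.map_d, hx, map_zero]))
    (by
      rintro ⟨x, hx⟩ ⟨y, hy⟩
      exact ⟨f.toFun c y, by rw [← f.map_d, hy]; rfl⟩)

/-- The map induces an isomorphism on homology (in every colour). -/
def DGOHom.IsQuasiIso {k : Type u} [Field k] {C : Type u} {O : ColoredOperad k C}
    {A B : DGOAlgebra O} (f : DGOHom A B) : Prop :=
  ∀ c, Function.Bijective (f.homologyMap c)

/-- The graded algebra `T` over `O` is free on the family of homogeneous generators `gen x`, of
colour `col x` and degree `deg x`. -/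
structure GradedOAlgebra.IsFreeOn {k : Type u} [Field k] {C : Type u} {O : ColoredOperad k C}
    (T : GradedOAlgebra O) {X : Type u} (col : X → C) (deg : X → ℤ)
    (gen : ∀ x, T.carrier (col x)) : Prop where
  gen_mem : ∀ x, gen x ∈ T.gr (col x) (deg x)
  existsUnique_hom : ∀ (B : GradedOAlgebra O) (g : ∀ x, B.carrier (col x)),
    (∀ x, g x ∈ B.gr (col x) (deg x)) → ∃! φ : GradedOHom T B, ∀ x, φ.toFun (col x) (gen x) = g x

/-- A dg algebra over `O` is free triangular if, after suppressing the differential, it is free on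
some generators which carry a partial order with all descending chains finite, such that the
differential of any generator is a sum of `O`-operations applied to strictly smaller generators. -/
def DGOAlgebra.IsFreeTriangular {k : Type u} [Field k] {C : Type u} {O : ColoredOperad k C}
    (T : DGOAlgebra O) : Prop :=
  ∃ (X : Type u) (col : X → C) (deg : X → ℤ) (gen : ∀ x, T.carrier (col x)),
    T.toGradedOAlgebra.IsFreeOn col deg gen ∧
    ∃ _ : PartialOrder X, WellFoundedLT X ∧
      ∀ x, T.d (col x) (gen x) ∈ Submodule.span k
        {z | ∃ (m : ℕ) (y : Fin m → X) (o : O.Op (fun i => col (y i)) (col x)),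
          (∀ i, y i < x) ∧ z = T.act o (fun i => gen (y i))}
/-- The parity operator, multiplication by `(-1) ^ n` on elements of degree `n`. -/
noncomputable def GradedOAlgebra.parity {k : Type u} [Field k] {C : Type u} {O : ColoredOperad k C}
    (A : GradedOAlgebra O) (c : C) : A.carrier c →ₗ[k] A.carrier c :=
  DirectSum.toModule k ℤ _ (fun n => (-1 : k) ^ n • (A.gr c n).subtype) ∘ₗ
    (LinearEquiv.ofBijective (DirectSum.coeLinearMap (A.gr c)) (A.isInternal c)).symm.toLinearMap

section Parity

variable {k : Type u} [Field k] {C : Type u} {O : ColoredOperad k C}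

theorem GradedOAlgebra.parity_of_mem (A : GradedOAlgebra O) {c : C} {n : ℤ} {x : A.carrier c}
    (hx : x ∈ A.gr c n) : A.parity c x = (-1 : k) ^ n • x := by
  have h : (LinearEquiv.ofBijective (DirectSum.coeLinearMap (A.gr c)) (A.isInternal c)).symm x =
      DirectSum.of (fun n => A.gr c n) n ⟨x, hx⟩ := by
    rw [LinearEquiv.symm_apply_eq]
    exact (DirectSum.coeLinearMap_of (A.gr c) n ⟨x, hx⟩).symm
  simp only [parity, LinearMap.comp_apply, LinearEquiv.coe_coe, h]
  rw [← DirectSum.lof_eq_of k, DirectSum.toModule_lof]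
  simp

theorem GradedOAlgebra.parity_mem (A : GradedOAlgebra O) {c : C} {n : ℤ} {x : A.carrier c}
    (hx : x ∈ A.gr c n) : A.parity c x ∈ A.gr c n := by
  rw [A.parity_of_mem hx]; exact Submodule.smul_mem _ _ hx

theorem GradedOAlgebra.linearMap_ext (A : GradedOAlgebra O) {c : C} {N : Type*} [AddCommGroup N]
    [Module k N] {f g : A.carrier c →ₗ[k] N} (h : ∀ n, ∀ x ∈ A.gr c n, f x = g x) : f = g := by
  ext x
  have hx : x ∈ ⨆ n, A.gr c n := by
    rw [(A.isInternal c).submodule_iSup_eq_top]; trivial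
  induction hx using Submodule.iSup_induction' with
  | mem n x hx => exact h n x hx
  | zero => simp
  | add x y _ _ hx hy => simp [hx, hy]

theorem GradedOAlgebra.multilinearMap_ext (A : GradedOAlgebra O) {I : Type} [Finite I] {a : I → C}
    {N : Type*} [AddCommGroup N] [Module k N]
    {f g : MultilinearMap k (fun i => A.carrier (a i)) N}
    (h : ∀ (n : I → ℤ) (x : ∀ i, A.carrier (a i)), (∀ i, x i ∈ A.gr (a i) (n i)) → f x = g x) :
    f = g := by
  classical
  have key : ∀ x : ∀ i, DirectSum ℤ (fun n => A.gr (a i) n),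
      f (fun i => DirectSum.coeLinearMap (A.gr (a i)) (x i)) =
        g (fun i => DirectSum.coeLinearMap (A.gr (a i)) (x i)) := by
    intro x
    have : f.compLinearMap (M₁ := fun i => Π₀ n : ℤ, A.gr (a i) n)
        (fun i => DirectSum.coeLinearMap (A.gr (a i))) =
        g.compLinearMap (M₁ := fun i => Π₀ n : ℤ, A.gr (a i) n)
        (fun i => DirectSum.coeLinearMap (A.gr (a i))) := by
      apply MultilinearMap.dfinsupp_ext
      intro p
      ext y
      refine h p _ fun i => ?_
      have : DirectSum.coeLinearMap (A.gr (a i))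
          (DirectSum.lof k ℤ (fun n => A.gr (a i) n) (p i) (y i)) ∈ A.gr (a i) (p i) := by
        simp
      exact this
    exact congrArg (fun F => F x) this
  ext x
  have hx : ∀ i, ∃ y, DirectSum.coeLinearMap (A.gr (a i)) y = x i := fun i =>
    (A.isInternal (a i)).surjective (x i)
  choose y hy using hx
  simpa [hy] using key y

theorem GradedOAlgebra.parity_comm (A : GradedOAlgebra O) {c : C}
    {f : A.carrier c →ₗ[k] A.carrier c} (m : ℤ)
    (hf : ∀ n, ∀ x ∈ A.gr c n, f x ∈ A.gr c (n + m)) (x : A.carrier c) :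
    A.parity c (f x) = (-1 : k) ^ m • f (A.parity c x) := by
  have : A.parity c ∘ₗ f = (-1 : k) ^ m • (f ∘ₗ A.parity c) := by
    apply A.linearMap_ext
    intro n x hx
    simp only [LinearMap.comp_apply, LinearMap.smul_apply]
    rw [A.parity_of_mem (hf n x hx), A.parity_of_mem hx, map_smul, smul_smul,
      zpow_add₀ (by simp), mul_comm]
  exact congrArg (fun F => F x) this

theorem zpow_neg_one_sum {I : Type*} (s : Finset I) (n : I → ℤ) :
    (-1 : k) ^ (∑ i ∈ s, n i) = ∏ i ∈ s, (-1 : k) ^ n i := by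
  classical
  induction s using Finset.induction_on with
  | empty => simp
  | insert i s hi ih => rw [Finset.sum_insert hi, Finset.prod_insert hi, zpow_add₀ (by simp), ih]

theorem GradedOAlgebra.parity_act (A : GradedOAlgebra O) {I : Type} [Fintype I] [LinearOrder I]
    {a : I → C} {c : C} (o : O.Op a c) (x : ∀ i, A.carrier (a i)) :
    A.parity c (A.act o x) = A.act o (fun i => A.parity (a i) (x i)) := by
  have : (A.parity c).compMultilinearMap (A.act o) =
      (A.act o).compLinearMap (fun i => A.parity (a i)) := by
    apply A.multilinearMap_ext
    intro n x hx
    simp only [LinearMap.compMultilinearMap_apply, MultilinearMap.compLinearMap_apply]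
    rw [A.parity_of_mem (A.act_mem o n x hx)]
    simp_rw [fun i => A.parity_of_mem (hx i)]
    rw [MultilinearMap.map_smul_univ, zpow_neg_one_sum]
  exact congrArg (fun F => F x) this

end Parity

section AdjoinDt

variable {k : Type u} [Field k] {C : Type u} {O : ColoredOperad k C}

/-- Auxiliary: the map applied to the `j`-th factor when `dt` is extracted from the `i`-th one. -/
noncomputable def GradedOAlgebra.dtFactor (B : GradedOAlgebra O) {I : Type} [LinearOrder I]
    (a : I → C) (i j : I) : (B.carrier (a j) × B.carrier (a j)) →ₗ[k] B.carrier (a j) :=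
  if j < i then LinearMap.fst k _ _ else if j = i then LinearMap.snd k _ _
  else B.parity (a j) ∘ₗ LinearMap.fst k _ _

theorem GradedOAlgebra.dtFactor_of_lt (B : GradedOAlgebra O) {I : Type} [LinearOrder I]
    (a : I → C) {i j : I} (h : j < i) (x : B.carrier (a j) × B.carrier (a j)) :
    B.dtFactor a i j x = x.1 := by
  simp [dtFactor, h]

theorem GradedOAlgebra.dtFactor_self (B : GradedOAlgebra O) {I : Type} [LinearOrder I]
    (a : I → C) (i : I) (x : B.carrier (a i) × B.carrier (a i)) :
    B.dtFactor a i i x = x.2 := by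
  simp [dtFactor]

theorem GradedOAlgebra.dtFactor_of_gt (B : GradedOAlgebra O) {I : Type} [LinearOrder I]
    (a : I → C) {i j : I} (h : i < j) (x : B.carrier (a j) × B.carrier (a j)) :
    B.dtFactor a i j x = B.parity (a j) x.1 := by
  simp [dtFactor, h.not_gt, h.ne']

theorem GradedOAlgebra.dtFactor_mem (B : GradedOAlgebra O) {I : Type} [LinearOrder I]
    (a : I → C) (i j : I) (n : I → ℤ) (x : B.carrier (a j) × B.carrier (a j))
    (hx : x ∈ (B.gr (a j) (n j)).prod (B.gr (a j) (n j + 1))) :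
    B.dtFactor a i j x ∈ B.gr (a j) (Function.update n i (n i + 1) j) := by
  unfold dtFactor
  split_ifs with h h'
  · rw [Function.update_of_ne h.ne]; exact hx.1
  · subst h'; simpa using hx.2
  · rw [Function.update_of_ne h']; exact B.parity_mem hx.1

theorem sum_update_add_one {I : Type} [Fintype I] [DecidableEq I] (n : I → ℤ) (i : I) :
    ∑ j, Function.update n i (n i + 1) j = ∑ j, n j + 1 := by
  rw [Finset.sum_update_of_mem (Finset.mem_univ i), ← Finset.add_sum_erase _ n (Finset.mem_univ i),
    Finset.sdiff_singleton_eq_erase]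
  ring

theorem koszulSign_update {I J : Type} [Fintype I] [LinearOrder I] [LinearOrder J]
    (e : I ≃ J) (n : J → ℤ) (i : I) :
    koszulSign k e (Function.update n (e i) (n (e i) + 1)) = koszulSign k e n *
      ((∏ q, if i < q ∧ e q < e i then (-1 : k) ^ n (e q) else 1) *
        ∏ p, if p < i ∧ e i < e p then (-1 : k) ^ n (e p) else 1) := by
  have h1 : (∏ q, if i < q ∧ e q < e i then (-1 : k) ^ n (e q) else 1) =
      ∏ p, ∏ q, if p = i then (if i < q ∧ e q < e i then (-1 : k) ^ n (e q) else 1) else 1 := by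
    rw [Finset.prod_comm]; simp
  have h2 : (∏ p, if p < i ∧ e i < e p then (-1 : k) ^ n (e p) else 1) =
      ∏ p, ∏ q, if q = i then (if p < i ∧ e i < e p then (-1 : k) ^ n (e p) else 1) else 1 := by
    simp
  rw [h1, h2, koszulSign, koszulSign, ← Finset.prod_mul_distrib, ← Finset.prod_mul_distrib]
  refine Finset.prod_congr rfl fun p _ => ?_
  rw [← Finset.prod_mul_distrib, ← Finset.prod_mul_distrib]
  refine Finset.prod_congr rfl fun q _ => ?_
  have hne : (-1 : k) ≠ 0 := by simp
  by_cases hp : p = i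
  · subst hp
    by_cases hq : q = p
    · subst hq; simp
    · by_cases hc : p < q ∧ e q < e p
      · simp [hc, hq, add_mul, zpow_add₀ hne]
      · simp [hc, hq]
  · by_cases hq : q = i
    · subst hq
      by_cases hc : p < q ∧ e q < e p
      · simp [hc, hp, mul_add, zpow_add₀ hne]
      · simp [hc, hp]
    · by_cases hc : p < q ∧ e q < e p
      · simp [hc, hp, hq]
      · simp [hc, hp, hq]

theorem isInternal_prod_shift {M : Type*} [AddCommGroup M] [Module k M] (G : ℤ → Submodule k M)
    (hG : DirectSum.IsInternal G) :
    DirectSum.IsInternal (fun n => (G n).prod (G (n + 1))) := by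
  rw [DirectSum.isInternal_submodule_iff_iSupIndep_and_iSup_eq_top] at hG ⊢
  obtain ⟨hi, ht⟩ := hG
  constructor
  · intro n
    rw [Submodule.disjoint_def]
    intro x hx hx'
    have h1 : x.1 ∈ ⨆ m, ⨆ (_ : m ≠ n), G m := by
      have := Submodule.mem_map_of_mem (f := LinearMap.fst k M M) hx'
      simp only [Submodule.map_iSup] at this
      refine (iSup₂_mono (fun m hm => ?_) :
        _ ≤ ⨆ m, ⨆ (_ : m ≠ n), G m) this
      rintro _ ⟨y, hy, rfl⟩
      exact hy.1
    have h2 : x.2 ∈ ⨆ m, ⨆ (_ : m ≠ n + 1), G m := by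
      have := Submodule.mem_map_of_mem (f := LinearMap.snd k M M) hx'
      simp only [Submodule.map_iSup] at this
      refine (iSup₂_le (fun m hm => ?_) :
        _ ≤ ⨆ m, ⨆ (_ : m ≠ n + 1), G m) this
      rintro _ ⟨y, hy, rfl⟩
      exact Submodule.mem_iSup_of_mem (m + 1) (Submodule.mem_iSup_of_mem (by simpa using hm) hy.2)
    exact Prod.ext ((Submodule.disjoint_def.1 (hi n)) _ hx.1 h1)
      ((Submodule.disjoint_def.1 (hi (n + 1))) _ hx.2 h2)
  · rw [eq_top_iff]
    rintro ⟨x, y⟩ -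
    have hx : (x, (0 : M)) ∈ ⨆ n, (G n).prod (G (n + 1)) := by
      have h : x ∈ ⨆ n, G n := by rw [ht]; trivial
      have := Submodule.mem_map_of_mem (f := LinearMap.inl k M M) h
      simp only [Submodule.map_iSup] at this
      refine (iSup_mono (fun m => ?_) :
        _ ≤ ⨆ n, (G n).prod (G (n + 1))) this
      rintro _ ⟨y, hy, rfl⟩
      exact ⟨hy, Submodule.zero_mem _⟩
    have hy : ((0 : M), y) ∈ ⨆ n, (G n).prod (G (n + 1)) := by
      have h : y ∈ ⨆ n, G n := by rw [ht]; trivial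
      have := Submodule.mem_map_of_mem (f := LinearMap.inr k M M) h
      simp only [Submodule.map_iSup] at this
      refine (iSup_le (fun m => ?_) :
        _ ≤ ⨆ n, (G n).prod (G (n + 1))) this
      rintro _ ⟨z, hz, rfl⟩
      exact Submodule.mem_iSup_of_mem (m - 1) ⟨Submodule.zero_mem _, by simpa using hz⟩
    simpa using Submodule.add_mem _ hx hy

/-- The action of `O` on `B ⊕ B dt`, where `dt` has degree `-1` and square zero, and `(u, v)` stands
for `u + v dt`.  An operation applied to elements `u i + v i dt` has `dt`-component the sum over `i`
of its values on `u j` (`j < i`), `v i`, and `± u j` (`j > i`); the signs come from moving `dt` to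
the right. -/
noncomputable def GradedOAlgebra.dtAct (B : GradedOAlgebra O) {I : Type} [Fintype I] [LinearOrder I]
    {a : I → C} {c : C} : O.Op a c →ₗ[k]
      MultilinearMap k (fun i => B.carrier (a i) × B.carrier (a i))
        (B.carrier c × B.carrier c) where
  toFun o := ((B.act o).compLinearMap (fun _ => LinearMap.fst k _ _)).prod
    (∑ i, (B.act o).compLinearMap (B.dtFactor a i))
  map_add' o o' := by
    ext x
    · simp
    · simp [Finset.sum_add_distrib, _root_.sum_apply]
  map_smul' r o := by
    ext x
    · simp
    · simp [Finset.smul_sum, _root_.sum_apply]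

theorem GradedOAlgebra.dtAct_apply (B : GradedOAlgebra O) {I : Type} [Fintype I] [LinearOrder I]
    {a : I → C} {c : C} (o : O.Op a c) (x : ∀ i, B.carrier (a i) × B.carrier (a i)) :
    B.dtAct o x = (B.act o (fun i => (x i).1), ∑ i, B.act o (fun j => B.dtFactor a i j (x j))) := by
  refine Prod.ext ?_ ?_
  · simp [dtAct]
  · simp [dtAct, _root_.sum_apply]

/-- The graded algebra `B ⊕ B dt` over `O`. -/
noncomputable def GradedOAlgebra.adjoinDt (B : GradedOAlgebra O) : GradedOAlgebra O where
  carrier c := B.carrier c × B.carrier c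
  gr c n := (B.gr c n).prod (B.gr c (n + 1))
  isInternal c := isInternal_prod_shift _ (B.isInternal c)
  act := B.dtAct
  act_mem {I} _ _ {a} {c} o n x hx := by
    rw [B.dtAct_apply]
    refine ⟨B.act_mem o n _ fun i => (hx i).1, ?_⟩
    dsimp only
    refine Submodule.sum_mem _ fun i _ => ?_
    rw [← sum_update_add_one n i]
    exact B.act_mem o _ _ fun j => B.dtFactor_mem a i j n _ (hx j)
  act_one c x := by
    rw [B.dtAct_apply]
    refine Prod.ext ?_ ?_
    · simp [B.act_one]
    · simp [B.act_one, B.dtFactor_self]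
  act_comp {I} _ _ {J} _ _ {b} {a} {c} o p x := by
    rw [@GradedOAlgebra.dtAct_apply _ _ _ _ B (Σ i, J i) _ (sigmaLexOrder J)]
    simp only [B.dtAct_apply]
    refine Prod.ext ?_ ?_
    · simp [B.act_comp]
    · dsimp only
      rw [Fintype.sum_sigma]
      refine Finset.sum_congr rfl fun i _ => ?_
      have hR : (fun i' => B.dtFactor a i i' ((B.act (p i')) fun j => (x ⟨i', j⟩).1,
          ∑ j, (B.act (p i')) fun j' => B.dtFactor (b i') j j' (x ⟨i', j'⟩))) =
          Function.update (fun i' => B.dtFactor a i i' ((B.act (p i')) fun j => (x ⟨i', j⟩).1, 0)) i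
            (∑ j, (B.act (p i)) fun j' => B.dtFactor (b i) j j' (x ⟨i, j'⟩)) := by
        funext i'
        by_cases h : i' = i
        · subst h; simp [GradedOAlgebra.dtFactor]
        · rw [Function.update_of_ne h]
          simp only [GradedOAlgebra.dtFactor, h, if_false]
          split_ifs <;> simp
      refine Eq.trans ?_ (congrArg (B.act o) hR).symm
      rw [MultilinearMap.map_update_sum]
      refine Finset.sum_congr rfl fun j _ => ?_
      rw [B.act_comp]
      congr 1
      funext i'
      by_cases h : i' = i
      · subst h
        rw [Function.update_self]
        congr 1
        funext j'
        rcases lt_trichotomy j' j with h | h | h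
        · rw [B.dtFactor_of_lt _ h]
          exact @GradedOAlgebra.dtFactor_of_lt _ _ _ _ B (Σ i, J i) (sigmaLexOrder J)
            (fun q => b q.1 q.2) ⟨i', j⟩ ⟨i', j'⟩ (Sigma.Lex.right _ _ h) _
        · subst h
          rw [B.dtFactor_self (b i')]
          exact @GradedOAlgebra.dtFactor_self _ _ _ _ B (Σ i, J i) (sigmaLexOrder J)
            (fun q => b q.1 q.2) ⟨i', j'⟩ _
        · rw [B.dtFactor_of_gt _ h]
          exact @GradedOAlgebra.dtFactor_of_gt _ _ _ _ B (Σ i, J i) (sigmaLexOrder J)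
            (fun q => b q.1 q.2) ⟨i', j⟩ ⟨i', j'⟩ (Sigma.Lex.right _ _ h) _
      · rw [Function.update_of_ne h]
        rcases lt_or_gt_of_ne h with h | h
        · rw [B.dtFactor_of_lt _ h]
          congr 1
          funext j'
          exact @GradedOAlgebra.dtFactor_of_lt _ _ _ _ B (Σ i, J i) (sigmaLexOrder J)
            (fun q => b q.1 q.2) ⟨i, j⟩ ⟨i', j'⟩ (Sigma.Lex.left _ _ h) _
        · rw [B.dtFactor_of_gt _ h, B.parity_act]
          congr 1
          funext j'
          exact @GradedOAlgebra.dtFactor_of_gt _ _ _ _ B (Σ i, J i) (sigmaLexOrder J)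
            (fun q => b q.1 q.2) ⟨i, j⟩ ⟨i', j'⟩ (Sigma.Lex.left _ _ h) _
  act_relabel {I J} _ _ _ _ e {a} {c} o n x hx := by
    rw [B.dtAct_apply, B.dtAct_apply]
    refine Prod.ext ?_ ?_
    · simpa using B.act_relabel e o n (fun j => (x j).1) (fun j => (hx j).1)
    · simp only [Prod.smul_snd, Finset.smul_sum]
      rw [← Equiv.sum_comp e]
      refine Finset.sum_congr rfl fun i _ => ?_
      rw [B.act_relabel e o (Function.update n (e i) (n (e i) + 1)) _
        (fun j => B.dtFactor_mem a (e i) j n _ (hx j)), koszulSign_update]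
      set w : ∀ i', B.carrier (a (e i')) := fun i' => if i' = i then (x (e i')).2 else (x (e i')).1
        with hw
      have hL : (fun i' => B.dtFactor a (e i) (e i') (x (e i'))) =
          fun i' => (if e i < e i' then (-1 : k) ^ n (e i') else 1) • w i' := by
        funext i'
        simp only [GradedOAlgebra.dtFactor, hw, EmbeddingLike.apply_eq_iff_eq]
        by_cases h : i' = i
        · subst h; simp
        · rcases lt_or_gt_of_ne (e.injective.ne h) with h' | h'
          · simp [h, h', h'.not_gt]
          · simp [h, h', h'.not_gt, B.parity_of_mem (hx (e i')).1]
      have hR : (fun i' => B.dtFactor (fun i => a (e i)) i i' (x (e i'))) =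
          fun i' => (if i < i' then (-1 : k) ^ n (e i') else 1) • w i' := by
        funext i'
        simp only [GradedOAlgebra.dtFactor, hw]
        by_cases h : i' = i
        · subst h; simp
        · rcases lt_or_gt_of_ne h with h' | h'
          · simp [h, h', h'.not_gt]
          · simp [h, h', h'.not_gt, B.parity_of_mem (hx (e i')).1]
      rw [hL, hR, MultilinearMap.map_smul_univ, MultilinearMap.map_smul_univ, smul_smul, smul_smul,
        mul_assoc]
      congr 2
      rw [← Finset.prod_mul_distrib, ← Finset.prod_mul_distrib]
      refine Finset.prod_congr rfl fun q _ => ?_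
      have hsq : (-1 : k) ^ n (e q) * (-1 : k) ^ n (e q) = 1 := by
        rw [← mul_zpow]; simp
      by_cases h : q = i
      · subst h; simp
      · rcases lt_or_gt_of_ne h with h1 | h1 <;>
          rcases lt_or_gt_of_ne (e.injective.ne h) with h2 | h2 <;>
          simp [h1, h2, h1.not_gt, h2.not_gt, hsq]

theorem DGOAlgebra.dt_leibniz (B : DGOAlgebra O) (D : ∀ c, B.carrier c →ₗ[k] B.carrier c)
    (hDm : ∀ c n, ∀ x ∈ B.gr c n, D c x ∈ B.gr c n)
    {I : Type} [Fintype I] [LinearOrder I] {a : I → C} {c : C} (o : O.Op a c)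
    (hD : ∀ x : ∀ i, B.carrier (a i),
      D c (B.act o x) = ∑ i, B.act o (Function.update x i (D (a i) (x i))))
    (n : I → ℤ) (x : ∀ i, B.carrier (a i) × B.carrier (a i))
    (hx : ∀ i, x i ∈ (B.gr (a i) (n i)).prod (B.gr (a i) (n i + 1))) :
    B.d c (∑ l, B.act o (fun j => B.dtFactor a l j (x j))) +
        B.parity c (D c (B.act o (fun j => (x j).1))) =
      ∑ i, (-1 : k) ^ (∑ j with j < i, n j) • ∑ l, B.act o (fun j => B.dtFactor a l j
        (Function.update x i (B.d (a i) (x i).1,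
          B.d (a i) (x i).2 + B.parity (a i) (D (a i) (x i).1)) j)) := by
  set S : I → k := fun i => (-1 : k) ^ (∑ j with j < i, n j) with hS
  set F : I → I → B.carrier c := fun l i =>
    (-1 : k) ^ (∑ j with j < i, Function.update n l (n l + 1) j) •
      B.act o (Function.update (fun j => B.dtFactor a l j (x j)) i
        (B.d (a i) (B.dtFactor a l i (x i)))) with hF
  set E : I → B.carrier c := fun i =>
    B.parity c (B.act o (Function.update (fun j => (x j).1) i (D (a i) (x i).1))) with hE
  have hL : ∀ l, B.d c (B.act o (fun j => B.dtFactor a l j (x j))) = ∑ i, F l i := fun l =>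
    B.d_act o (Function.update n l (n l + 1)) _ fun j => B.dtFactor_mem a l j n _ (hx j)
  rw [hD, map_sum, map_sum]
  simp only [hL]
  rw [Finset.sum_comm, ← Finset.sum_add_distrib]
  refine Finset.sum_congr rfl fun i _ => ?_
  rw [Finset.smul_sum]
  have key : ∀ l, (-1 : k) ^ (∑ j with j < i, n j) • B.act o (fun j => B.dtFactor a l j
        (Function.update x i (B.d (a i) (x i).1,
          B.d (a i) (x i).2 + B.parity (a i) (D (a i) (x i).1)) j)) =
      F l i + if l = i then E i else 0 := by
    intro l
    have hfun : (fun j => B.dtFactor a l j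
        (Function.update x i (B.d (a i) (x i).1,
          B.d (a i) (x i).2 + B.parity (a i) (D (a i) (x i).1)) j)) =
        Function.update (fun j => B.dtFactor a l j (x j)) i (B.dtFactor a l i
          (B.d (a i) (x i).1, B.d (a i) (x i).2 + B.parity (a i) (D (a i) (x i).1))) := by
      funext j
      by_cases h : j = i
      · subst h; simp
      · simp [h]
    rw [hfun]
    rcases lt_trichotomy i l with h | h | h
    · simp only [hF, B.dtFactor_of_lt a h, if_neg h.ne', add_zero]
      congr 2
      refine Finset.sum_congr rfl fun j hj => ?_
      rw [Function.update_of_ne]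
      exact ((Finset.mem_filter.1 hj).2.trans h).ne
    · subst h
      simp only [B.dtFactor_self, if_true, MultilinearMap.map_update_add, smul_add]
      congr 1
      · simp only [hF, B.dtFactor_self]
        congr 2
        refine Finset.sum_congr rfl fun j hj => ?_
        rw [Function.update_of_ne]
        exact (Finset.mem_filter.1 hj).2.ne
      · simp only [hE]
        have hmem : ∀ j, Function.update (fun j => (x j).1) i (D (a i) (x i).1) j ∈
            B.gr (a j) (n j) := by
          intro j
          by_cases h : j = i
          · subst h; simpa using hDm _ _ _ (hx j).1
          · simpa [h] using (hx j).1
        rw [B.parity_of_mem (B.act_mem o n _ hmem)]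
        have : Function.update (fun j => B.dtFactor a i j (x j)) i
            (B.parity (a i) (D (a i) (x i).1)) = fun j => (if j < i then 1 else (-1 : k) ^ n j) •
              Function.update (fun j => (x j).1) i (D (a i) (x i).1) j := by
          funext j
          rcases lt_trichotomy j i with h | h | h
          · simp [h.ne, h, B.dtFactor_of_lt]
          · subst h
            simp [B.parity_of_mem (hDm _ _ _ (hx j).1)]
          · simp [h.ne', h.not_gt, B.dtFactor_of_gt _ h, B.parity_of_mem (hx j).1]
        rw [this, MultilinearMap.map_smul_univ, smul_smul, zpow_neg_one_sum, zpow_neg_one_sum,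
          Finset.prod_filter, ← Finset.prod_mul_distrib]
        congr 1
        refine Finset.prod_congr rfl fun j _ => ?_
        split_ifs <;> simp
    · simp only [hF, B.dtFactor_of_gt a h, if_neg h.ne, add_zero]
      have hp : B.parity (a i) (B.d (a i) (x i).1) = -B.d (a i) (B.parity (a i) (x i).1) := by
        rw [B.parity_comm (-1) (fun n x hx => B.d_mem (a i) n x hx)]
        simp
      rw [hp, ← neg_one_smul k (B.d (a i) (B.parity (a i) (x i).1)), MultilinearMap.map_update_smul,
        smul_smul]
      congr 1
      rw [zpow_neg_one_sum, zpow_neg_one_sum]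
      have hl : l ∈ Finset.univ.filter (· < i) := by simpa using h
      rw [← Finset.mul_prod_erase _ _ hl, ← Finset.mul_prod_erase _ _ hl, Function.update_self,
        zpow_add₀ (by simp)]
      have : ∏ j ∈ (Finset.univ.filter (· < i)).erase l,
          (-1 : k) ^ Function.update n l (n l + 1) j =
          ∏ j ∈ (Finset.univ.filter (· < i)).erase l, (-1 : k) ^ n j := by
        refine Finset.prod_congr rfl fun j hj => ?_
        rw [Function.update_of_ne (Finset.ne_of_mem_erase hj)]
      rw [this]
      simp
  simp only [key, Finset.sum_add_distrib]
  simp [hE]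

/-- The differential `u + v dt ↦ d u + (d v + (-1) ^ n D u) dt` (for `u` of degree `n`) on
`B ⊕ B dt`, where `D` is a degree `0` derivation of `B` ("differentiation with respect to `t`"). -/
noncomputable def DGOAlgebra.dtDiff (B : DGOAlgebra O) (D : ∀ c, B.carrier c →ₗ[k] B.carrier c)
    (c : C) : (B.carrier c × B.carrier c) →ₗ[k] (B.carrier c × B.carrier c) :=
  (B.d c ∘ₗ LinearMap.fst k _ _).prod
    (B.d c ∘ₗ LinearMap.snd k _ _ + B.parity c ∘ₗ D c ∘ₗ LinearMap.fst k _ _)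

theorem DGOAlgebra.dtDiff_apply (B : DGOAlgebra O) (D : ∀ c, B.carrier c →ₗ[k] B.carrier c)
    (c : C) (x : B.carrier c × B.carrier c) :
    B.dtDiff D c x = (B.d c x.1, B.d c x.2 + B.parity c (D c x.1)) := rfl

/-- The dg algebra `B ⊕ B dt` over `O`, for a dg algebra `B` over `O` with a degree `0` derivation
`D` ("differentiation with respect to `t`") commuting with the differential. -/
noncomputable def DGOAlgebra.adjoinDt (B : DGOAlgebra O) (D : ∀ c, B.carrier c →ₗ[k] B.carrier c)
    (hDm : ∀ c n, ∀ x ∈ B.gr c n, D c x ∈ B.gr c n) (hDd : ∀ c x, D c (B.d c x) = B.d c (D c x))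
    (hD : ∀ {I : Type} [Fintype I] [LinearOrder I] {a : I → C} {c : C} (o : O.Op a c)
      (x : ∀ i, B.carrier (a i)),
      D c (B.act o x) = ∑ i, B.act o (Function.update x i (D (a i) (x i)))) : DGOAlgebra O where
  toGradedOAlgebra := B.toGradedOAlgebra.adjoinDt
  d c := B.dtDiff D c
  d_mem c n := by
    change ∀ x : B.carrier c × B.carrier c, x ∈ (B.gr c n).prod (B.gr c (n + 1)) →
      B.dtDiff D c x ∈ (B.gr c (n - 1)).prod (B.gr c (n - 1 + 1))
    intro x hx
    rw [B.dtDiff_apply]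
    refine ⟨B.d_mem c n _ hx.1, Submodule.add_mem _ ?_ ?_⟩
    · have := B.d_mem c (n + 1) _ hx.2
      rwa [add_sub_right_comm] at this
    · rw [sub_add_cancel]
      exact B.parity_mem (hDm c n _ hx.1)
  d_d c := by
    change ∀ x : B.carrier c × B.carrier c, B.dtDiff D c (B.dtDiff D c x) = 0
    intro x
    have h : B.parity c (B.d c (D c x.1)) = -B.d c (B.parity c (D c x.1)) := by
      rw [B.parity_comm (-1) (fun n x hx => B.d_mem c n x hx)]
      simp
    rw [B.dtDiff_apply, B.dtDiff_apply]
    simp [B.d_d, hDd, h]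
  d_act {I} _ _ {a} {c} o n := by
    change ∀ x : ∀ i, B.carrier (a i) × B.carrier (a i),
      (∀ i, x i ∈ (B.gr (a i) (n i)).prod (B.gr (a i) (n i + 1))) →
      B.dtDiff D c (B.dtAct o x) = ∑ i, (-1 : k) ^ (∑ j with j < i, n j) •
        B.dtAct o (Function.update x i (B.dtDiff D (a i) (x i)))
    intro x hx
    simp only [B.dtAct_apply, B.dtDiff_apply]
    refine Prod.ext ?_ ?_
    · rw [Prod.fst_sum]
      dsimp only
      rw [B.d_act o n _ fun i => (hx i).1]
      refine Finset.sum_congr rfl fun i _ => ?_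
      rw [Prod.smul_fst]
      congr 2
      funext j
      by_cases h : j = i
      · subst h; simp
      · simp [h]
    · rw [Prod.snd_sum]
      exact B.dt_leibniz D hDm o (hD o) n x hx

end AdjoinDt
section Poly

variable {k : Type u} [Field k]

/-- Evaluation at `s` of the polynomial in `t` with coefficients in the vector space `M`, given by
its finitely supported family of coefficients. -/
noncomputable def polyEval (M : Type*) [AddCommGroup M] [Module k M] (s : k) :
    (Π₀ _ : ℕ, M) →ₗ[k] M :=
  DFinsupp.lsum k (fun m => s ^ m • LinearMap.id)

/-- The derivative with respect to `t` of polynomials with coefficients in `M`. -/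
noncomputable def polyDeriv (k : Type u) [Field k] (M : Type*) [AddCommGroup M] [Module k M] :
    (Π₀ _ : ℕ, M) →ₗ[k] (Π₀ _ : ℕ, M) :=
  DFinsupp.lsum k (fun m => (m : k) • DFinsupp.lsingle (R := k) (M := fun _ : ℕ => M) (m - 1))

/-- The extension of a multilinear map to polynomials, by multilinearity over `k[t]`:
it sends `x₁ t ^ m₁, …, xₙ t ^ mₙ` to `f (x₁, …, xₙ) t ^ (m₁ + ⋯ + mₙ)`. -/
noncomputable def polyExt {I : Type} [Fintype I] [DecidableEq I] {M : I → Type u} {N : Type u}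
    [∀ i, AddCommGroup (M i)] [∀ i, Module k (M i)] [AddCommGroup N] [Module k N]
    (f : MultilinearMap k M N) : MultilinearMap k (fun i => Π₀ _ : ℕ, M i) (Π₀ _ : ℕ, N) :=
  (DFinsupp.lsum k (fun p : I → ℕ => DFinsupp.lsingle (R := k) (M := fun _ : ℕ => N) (∑ i, p i))
    ).compMultilinearMap (MultilinearMap.dfinsuppFamily (κ := fun _ => ℕ) (fun _ => f))

theorem polyEval_single {M : Type*} [AddCommGroup M] [Module k M] (s : k) (m : ℕ) (x : M) :
    polyEval M s (DFinsupp.single m x) = s ^ m • x := by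
  simp [polyEval]

theorem polyDeriv_single {M : Type*} [AddCommGroup M] [Module k M] (m : ℕ) (x : M) :
    polyDeriv k M (DFinsupp.single m x) = (m : k) • DFinsupp.single (m - 1) x := by
  simp [polyDeriv]

theorem polyEval_mapRange {M N : Type*} [AddCommGroup M] [Module k M] [AddCommGroup N]
    [Module k N] (f : M →ₗ[k] N) (s : k) (x : Π₀ _ : ℕ, M) :
    polyEval N s (DFinsupp.mapRange.linearMap (fun _ => f) x) = f (polyEval M s x) := by
  have : polyEval N s ∘ₗ DFinsupp.mapRange.linearMap (fun _ => f) = f ∘ₗ polyEval M s := by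
    apply DFinsupp.lhom_ext
    intro m x
    simp [polyEval_single, DFinsupp.mapRange_single]
  exact congrArg (fun F => F x) this

theorem polyDeriv_mapRange {M N : Type*} [AddCommGroup M] [Module k M] [AddCommGroup N]
    [Module k N] (f : M →ₗ[k] N) (x : Π₀ _ : ℕ, M) :
    polyDeriv k N (DFinsupp.mapRange.linearMap (fun _ => f) x) =
      DFinsupp.mapRange.linearMap (fun _ => f) (polyDeriv k M x) := by
  have : polyDeriv k N ∘ₗ DFinsupp.mapRange.linearMap (fun _ => f) =
      DFinsupp.mapRange.linearMap (fun _ => f) ∘ₗ polyDeriv k M := by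
    apply DFinsupp.lhom_ext
    intro m x
    simp only [LinearMap.comp_apply, DFinsupp.mapRange.linearMap_apply, DFinsupp.mapRange_single,
      polyDeriv_single]
    rw [← DFinsupp.single_smul, ← DFinsupp.single_smul, DFinsupp.mapRange_single, map_smul]
  exact congrArg (fun F => F x) this

theorem polyExt_single {I : Type} [Fintype I] [DecidableEq I] {M : I → Type u} {N : Type u}
    [∀ i, AddCommGroup (M i)] [∀ i, Module k (M i)] [AddCommGroup N] [Module k N]
    (f : MultilinearMap k M N) (m : I → ℕ) (x : ∀ i, M i) :
    polyExt f (fun i => DFinsupp.single (m i) (x i)) = DFinsupp.single (∑ i, m i) (f x) := by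
  simp only [polyExt, LinearMap.compMultilinearMap_apply]
  rw [MultilinearMap.dfinsuppFamily_single (κ := fun _ => ℕ)]
  simp

theorem polyEval_polyExt {I : Type} [Fintype I] [DecidableEq I] {M : I → Type u} {N : Type u}
    [∀ i, AddCommGroup (M i)] [∀ i, Module k (M i)] [AddCommGroup N] [Module k N]
    (f : MultilinearMap k M N) (s : k) (x : ∀ i, Π₀ _ : ℕ, M i) :
    polyEval N s (polyExt f x) = f (fun i => polyEval (M i) s (x i)) := by
  have : (polyEval N s).compMultilinearMap (polyExt f) =
      f.compLinearMap (fun i => polyEval (M i) s) := by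
    apply MultilinearMap.dfinsupp_ext
    intro m
    ext y
    simp only [MultilinearMap.compLinearMap_apply, LinearMap.compMultilinearMap_apply,
      DFinsupp.lsingle_apply]
    rw [polyExt_single]
    simp only [polyEval_single]
    rw [MultilinearMap.map_smul_univ, Finset.prod_pow_eq_pow_sum]
  exact congrArg (fun F => F x) this

theorem polyDeriv_polyExt {I : Type} [Fintype I] [DecidableEq I] {M : I → Type u} {N : Type u}
    [∀ i, AddCommGroup (M i)] [∀ i, Module k (M i)] [AddCommGroup N] [Module k N]
    (f : MultilinearMap k M N) (x : ∀ i, Π₀ _ : ℕ, M i) :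
    polyDeriv k N (polyExt f x) =
      ∑ i, polyExt f (Function.update x i (polyDeriv k (M i) (x i))) := by
  have : (polyDeriv k N).compMultilinearMap (polyExt f) =
      ∑ i, (polyExt f).compLinearMap
        (fun j => if j = i then polyDeriv k (M j) else LinearMap.id) := by
    apply MultilinearMap.dfinsupp_ext
    intro m
    ext1 y
    simp only [MultilinearMap.compLinearMap_apply, LinearMap.compMultilinearMap_apply,
      DFinsupp.lsingle_apply, _root_.sum_apply]
    rw [polyExt_single, polyDeriv_single]
    have h : ∀ i, polyExt f (fun j => (if j = i then polyDeriv k (M j) else LinearMap.id)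
        (DFinsupp.single (m j) (y j))) = (m i : k) • DFinsupp.single (∑ i, m i - 1) (f y) := by
      intro i
      have h1 : (fun j => (if j = i then polyDeriv k (M j) else LinearMap.id)
          (DFinsupp.single (m j) (y j))) = fun j => (if j = i then (m i : k) else 1) •
            DFinsupp.single (Function.update m i (m i - 1) j) (y j) := by
        funext j
        by_cases h : j = i
        · subst h; simp [polyDeriv_single]
        · simp [h]
      rw [h1, MultilinearMap.map_smul_univ, polyExt_single]
      simp only [Finset.prod_ite_eq', Finset.mem_univ, if_true]
      rcases Nat.eq_zero_or_pos (m i) with h0 | h0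
      · simp [h0]
      · have : ∑ j, Function.update m i (m i - 1) j = ∑ i, m i - 1 := by
          rw [Finset.sum_update_of_mem (Finset.mem_univ i),
            ← Finset.add_sum_erase _ m (Finset.mem_univ i), Finset.sdiff_singleton_eq_erase]
          omega
        rw [this]
    simp only [h]
    rw [← Finset.sum_smul]
    simp
  refine (congrArg (fun F => F x) this).trans ?_
  simp only [_root_.sum_apply, MultilinearMap.compLinearMap_apply]
  refine Finset.sum_congr rfl fun i _ => ?_
  congr 1
  funext j
  by_cases h : j = i
  · subst h; simp
  · simp [h]

theorem poly_ext [CharZero k] {M : Type*} [AddCommGroup M] [Module k M] {x y : Π₀ _ : ℕ, M}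
    (h : ∀ s : k, polyEval M s x = polyEval M s y) : x = y := by
  ext m
  rw [← sub_eq_zero, ← Module.forall_dual_apply_eq_zero_iff k]
  intro l
  let T : (Π₀ _ : ℕ, M) →ₗ[k] Polynomial k := DFinsupp.lsum k (fun m => Polynomial.monomial m ∘ₗ l)
  have hT : ∀ (s : k) z, (T z).eval s = l (polyEval M s z) := by
    intro s z
    have : Polynomial.leval s ∘ₗ T = l ∘ₗ polyEval M s := by
      apply DFinsupp.lhom_ext
      intro m x
      simp [T, polyEval_single, mul_comm]
    exact congrArg (fun F => F z) this
  have hc : ∀ z, (T z).coeff m = l (z m) := by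
    intro z
    have : Polynomial.lcoeff k m ∘ₗ T = l ∘ₗ DFinsupp.lapply m := by
      apply DFinsupp.lhom_ext
      intro m' x
      simp [T, Polynomial.coeff_monomial, DFinsupp.single_apply]
      split_ifs <;> simp_all
    exact congrArg (fun F => F z) this
  have h0 : T (x - y) = 0 := by
    apply Polynomial.funext
    intro s
    rw [hT, map_sub, h s]
    simp
  have := hc (x - y)
  rw [h0] at this
  simpa using this.symm

/-- Polynomials with all coefficients in `G`. -/
def polySubmodule {M : Type*} [AddCommGroup M] [Module k M] (G : Submodule k M) :
    Submodule k (Π₀ _ : ℕ, M) :=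
  ⨅ m, G.comap (DFinsupp.lapply m)

theorem mem_polySubmodule {M : Type*} [AddCommGroup M] [Module k M] {G : Submodule k M}
    {x : Π₀ _ : ℕ, M} : x ∈ polySubmodule G ↔ ∀ m, x m ∈ G := by
  simp [polySubmodule]

theorem single_mem_polySubmodule {M : Type*} [AddCommGroup M] [Module k M] {G : Submodule k M}
    (m : ℕ) {x : M} (hx : x ∈ G) : DFinsupp.single m x ∈ polySubmodule G := by
  rw [mem_polySubmodule]
  intro m'
  by_cases h : m = m'
  · subst h; simpa using hx
  · rw [DFinsupp.single_eq_of_ne (Ne.symm h)]; exact G.zero_mem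

theorem lsum_mem_of_forall {ι M N : Type*} [DecidableEq ι] [AddCommGroup M] [Module k M]
    [AddCommGroup N] [Module k N] (f : ι → M →ₗ[k] N) (G : Submodule k N) (x : Π₀ _ : ι, M)
    (h : ∀ i, f i (x i) ∈ G) : DFinsupp.lsum k f x ∈ G := by
  rw [DFinsupp.lsum_apply_apply]
  exact dfinsuppSumAddHom_mem G x _ fun i _ => h i

theorem polyEval_mem {M : Type*} [AddCommGroup M] [Module k M] {G : Submodule k M}
    {x : Π₀ _ : ℕ, M} (s : k) (hx : x ∈ polySubmodule G) : polyEval M s x ∈ G :=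
  lsum_mem_of_forall _ _ _ fun m => G.smul_mem _ (mem_polySubmodule.1 hx m)

theorem polyDeriv_mem {M : Type*} [AddCommGroup M] [Module k M] {G : Submodule k M}
    {x : Π₀ _ : ℕ, M} (hx : x ∈ polySubmodule G) : polyDeriv k M x ∈ polySubmodule G :=
  lsum_mem_of_forall _ _ _ fun m => Submodule.smul_mem _ _
    (single_mem_polySubmodule _ (mem_polySubmodule.1 hx m))

theorem isInternal_polySubmodule {M : Type*} [AddCommGroup M] [Module k M] (G : ℤ → Submodule k M)
    (hG : DirectSum.IsInternal G) : DirectSum.IsInternal (fun n => polySubmodule (G n)) := by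
  rw [DirectSum.isInternal_submodule_iff_iSupIndep_and_iSup_eq_top] at hG ⊢
  obtain ⟨hi, ht⟩ := hG
  constructor
  · intro n
    rw [Submodule.disjoint_def]
    intro x hx hx'
    ext j
    refine (Submodule.disjoint_def.1 (hi n)) _ (mem_polySubmodule.1 hx j) ?_
    have := Submodule.mem_map_of_mem (f := DFinsupp.lapply (R := k) (M := fun _ : ℕ => M) j) hx'
    simp only [Submodule.map_iSup] at this
    refine (iSup₂_mono (fun m hm => ?_) : _ ≤ ⨆ m, ⨆ (_ : m ≠ n), G m) this
    rintro _ ⟨y, hy, rfl⟩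
    exact mem_polySubmodule.1 hy j
  · rw [eq_top_iff]
    rintro x -
    induction x using DFinsupp.induction with
    | h0 => exact Submodule.zero_mem _
    | ha m y f _ _ hf =>
      refine Submodule.add_mem _ ?_ hf
      have h : y ∈ ⨆ n, G n := by rw [ht]; trivial
      have := Submodule.mem_map_of_mem
        (f := DFinsupp.lsingle (R := k) (M := fun _ : ℕ => M) m) h
      simp only [Submodule.map_iSup] at this
      refine (iSup_mono (fun n => ?_) : _ ≤ ⨆ n, polySubmodule (G n)) this
      rintro _ ⟨z, hz, rfl⟩
      exact single_mem_polySubmodule m hz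

end Poly

section Path

variable {k : Type u} [Field k] [CharZero k] {C : Type u} {O : ColoredOperad k C}

/-- The dg algebra `A[t]` over `O` of polynomials with coefficients in `A`, where `t` has degree `0`
and everything is extended `k[t]`-linearly. -/
noncomputable def DGOAlgebra.poly (A : DGOAlgebra O) : DGOAlgebra O where
  carrier c := Π₀ _ : ℕ, A.carrier c
  gr c n := polySubmodule (A.gr c n)
  isInternal c := isInternal_polySubmodule _ (A.isInternal c)
  act {I} _ _ {a} {c} :=
    { toFun := fun o => polyExt (A.act o)
      map_add' := fun o o' => by
        refine MultilinearMap.ext fun x => ?_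
        apply poly_ext (k := k)
        intro s
        simp [polyEval_polyExt]
      map_smul' := fun r o => by
        refine MultilinearMap.ext fun x => ?_
        apply poly_ext (k := k)
        intro s
        simp [polyEval_polyExt] }
  act_mem o n x hx := by
    refine lsum_mem_of_forall _ _ _ fun p => ?_
    exact single_mem_polySubmodule _
      (A.act_mem o n _ fun i => mem_polySubmodule.1 (hx i) (p i))
  act_one c x := by
    apply poly_ext (k := k)
    intro s
    simp [polyEval_polyExt, A.act_one]
  act_comp o p x := by
    apply poly_ext (k := k)
    intro s
    simp [polyEval_polyExt, A.act_comp]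
  act_relabel e a c o n x hx := by
    apply poly_ext (k := k)
    intro s
    simp only [LinearMap.coe_mk, AddHom.coe_mk, polyEval_polyExt, map_smul]
    exact A.act_relabel e o n _ fun j => polyEval_mem s (hx j)
  d c := DFinsupp.mapRange.linearMap (fun _ => A.d c)
  d_mem c n x hx := by
    rw [mem_polySubmodule] at hx ⊢
    intro m
    simpa using A.d_mem c n _ (hx m)
  d_d c x := by
    ext m
    simp [A.d_d]
  d_act {I} _ _ {a} {c} o n x hx := by
    apply poly_ext (k := k)
    intro s
    simp only [LinearMap.coe_mk, AddHom.coe_mk, polyEval_polyExt, polyEval_mapRange, map_sum,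
      map_smul]
    rw [A.d_act o n _ fun j => polyEval_mem s (hx j)]
    refine Finset.sum_congr rfl fun i _ => ?_
    congr 2
    funext j
    by_cases h : j = i
    · subst h
      rw [Function.update_self, Function.update_self]
      exact (polyEval_mapRange _ s (x j)).symm
    · simp [h]

/-- The path object `A ⊗ k[t, dt] = A[t] ⊕ A[t] dt` of the dg algebra `A` over `O`, where
`k[t, dt]` is the commutative dg algebra of polynomial differential forms on the line. -/
noncomputable def DGOAlgebra.path (A : DGOAlgebra O) : DGOAlgebra O :=
  A.poly.adjoinDt (fun c => polyDeriv k (A.carrier c))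
    (fun _ _ _ hx => polyDeriv_mem hx)
    (fun c x => polyDeriv_mapRange (A.d c) x)
    (fun o x => polyDeriv_polyExt (A.act o) x)

/-- Evaluation of `A ⊗ k[t, dt]` at `t = s`, `dt = 0`. -/
noncomputable def DGOAlgebra.pathEval (A : DGOAlgebra O) (s : k) : DGOHom A.path A where
  toFun c := polyEval (A.carrier c) s ∘ₗ LinearMap.fst k (Π₀ _ : ℕ, A.carrier c) _
  map_gr _ _ _ hx := polyEval_mem s hx.1
  map_act o x := polyEval_polyExt (A.act o) s (fun i => (x i).1)
  map_d c x := polyEval_mapRange (A.d c) s x.1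

/-- Two maps `f, g : T → A` of dg algebras over `O` are homotopic if there is a map
`T → A ⊗ k[t, dt]` whose evaluations at `t = 0` and `t = 1` are `f` and `g`. -/
def DGOHom.Homotopic {T A : DGOAlgebra O} (f g : DGOHom T A) : Prop :=
  ∃ H : DGOHom T A.path, (A.pathEval 0).comp H = f ∧ (A.pathEval 1).comp H = g

end Path

/-! The proof replaces `p` by a surjection with acyclic kernel and then uses a lifting property of
`T`.

Lifting. Let `q : E → D` be surjective with acyclic kernel. Any map `T → D` lifts to `E`, one
generator at a time along the well-founded order. The values on smaller generators already determine
a cycle `z`, the image of the differential of the next generator; the value there must be a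
primitive of `z` with prescribed image under `q`. Any preimage under `q` can be corrected by an
element of the acyclic kernel (`exists_lift_elem`). This is `IsFreeTriangular.exists_lift`.

Existence. Let `E` consist of the pairs `(b, η)` with `η` a path in `A` starting at `p b`, and let
`q` take the endpoint of `η`. Since `p` is a quasi-isomorphism, `q` is surjective with acyclic
kernel (`isAcyclicFibration_mappingPathEnd`). A lift of `f` to `E` is exactly a map `g : T → B`
together with a homotopy from `p ∘ g` to `f`.

Uniqueness. Two maps `g`, `g'` with homotopies to `f` are two lifts `G`, `G'` of the same `f` to
`E`. The paths in `E` lying over constant paths in `A` map to `E ×_A E` by their endpoints, and this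
map is again surjective with acyclic kernel (`IsAcyclicFibration.verticalPathEnds`). Lifting `(G,
G')` gives a homotopy in `E`, which projects to `B`. Neither symmetry nor transitivity of the
homotopy relation is needed.

Both acyclicity statements rest on integrating forms over the interval, possible in characteristic
0: the integral of the `dt`-part of a closed path is a primitive of the difference of its endpoints,
and it is the obstruction to choosing a primitive path with prescribed endpoints. -/

/-! ### Homogeneous components, and the Leibniz rule without homogeneity. -/

section Components

variable {k : Type u} [Field k] {C : Type u} {O : ColoredOperad k C}

/-- The projection onto the homogeneous component of degree `n`. -/
noncomputable def GradedOAlgebra.proj (A : GradedOAlgebra O) (c : C) (n : ℤ) :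
    A.carrier c →ₗ[k] A.carrier c :=
  (A.gr c n).subtype ∘ₗ DirectSum.component k ℤ (fun n => A.gr c n) n ∘ₗ
    (LinearEquiv.ofBijective (DirectSum.coeLinearMap (A.gr c)) (A.isInternal c)).symm.toLinearMap

theorem GradedOAlgebra.proj_mem (A : GradedOAlgebra O) (c : C) (n : ℤ) (x : A.carrier c) :
    A.proj c n x ∈ A.gr c n :=
  Subtype.property _

theorem GradedOAlgebra.proj_of_mem (A : GradedOAlgebra O) {c : C} {m : ℤ} {x : A.carrier c}
    (hx : x ∈ A.gr c m) (n : ℤ) : A.proj c n x = if m = n then x else 0 := by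
  have h : (LinearEquiv.ofBijective (DirectSum.coeLinearMap (A.gr c)) (A.isInternal c)).symm x =
      DirectSum.lof k ℤ (fun n => A.gr c n) m ⟨x, hx⟩ := by
    rw [LinearEquiv.symm_apply_eq]
    exact (DirectSum.coeLinearMap_of (A.gr c) m ⟨x, hx⟩).symm
  simp only [proj, LinearMap.comp_apply, LinearEquiv.coe_coe, h]
  split_ifs with hmn
  · subst hmn
    rw [DirectSum.component.lof_self]
    rfl
  · rw [DirectSum.component.of, dif_neg hmn]
    rfl

theorem GradedOAlgebra.mem_of_proj_mem (A : GradedOAlgebra O) {c : C}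
    (S : Submodule k (A.carrier c))
    {x : A.carrier c} (h : ∀ n, A.proj c n x ∈ S) : x ∈ S := by
  obtain ⟨y, rfl⟩ := (A.isInternal c).surjective x
  have key : ∀ n, A.proj c n (DirectSum.coeLinearMap (A.gr c) y) = y n := by
    intro n
    have := (LinearEquiv.ofBijective (DirectSum.coeLinearMap (A.gr c))
      (A.isInternal c)).symm_apply_apply y
    change ((LinearEquiv.ofBijective (DirectSum.coeLinearMap (A.gr c))
      (A.isInternal c)).symm (DirectSum.coeLinearMap (A.gr c) y) n : A.carrier c) = y n
    exact congrArg (fun z : DirectSum ℤ (fun n => A.gr c n) => (z n : A.carrier c)) this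
  exact dfinsuppSumAddHom_mem S y _ fun n _ =>
    Eq.subst (motive := (· ∈ S)) (key n) (h n)

/-- The shift `m` serves two cases: `0` for morphisms and `-1` for differentials. -/
theorem GradedOAlgebra.proj_map {A B : GradedOAlgebra O} {c c' : C}
    (f : A.carrier c →ₗ[k] B.carrier c') (m : ℤ)
    (hf : ∀ n, ∀ x ∈ A.gr c n, f x ∈ B.gr c' (n + m)) (n : ℤ) (x : A.carrier c) :
    B.proj c' (n + m) (f x) = f (A.proj c n x) := by
  have : B.proj c' (n + m) ∘ₗ f = f ∘ₗ A.proj c n := by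
    apply A.linearMap_ext
    intro l x hx
    simp only [LinearMap.comp_apply, A.proj_of_mem hx, B.proj_of_mem (hf l x hx),
      add_left_inj]
    split_ifs <;> simp
  exact congrArg (fun F => F x) this

theorem GradedOHom.map_proj {A B : GradedOAlgebra O} (f : GradedOHom A B) (c : C) (n : ℤ)
    (x : A.carrier c) : f.toFun c (A.proj c n x) = B.proj c n (f.toFun c x) := by
  have := GradedOAlgebra.proj_map (f.toFun c) 0 (fun n x hx => by simpa using f.map_gr c n x hx) n x
  simpa using this.symm

theorem DGOAlgebra.d_proj (A : DGOAlgebra O) (c : C) (n : ℤ) (x : A.carrier c) :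
    A.d c (A.proj c n x) = A.proj c (n - 1) (A.d c x) :=
  (GradedOAlgebra.proj_map (A := A.toGradedOAlgebra) (B := A.toGradedOAlgebra) (A.d c) (-1)
    (fun n x hx => A.d_mem c n x hx) n x).symm

theorem GradedOAlgebra.parity_parity (A : GradedOAlgebra O) {c : C} (x : A.carrier c) :
    A.parity c (A.parity c x) = x := by
  have : A.parity c ∘ₗ A.parity c = LinearMap.id := by
    apply A.linearMap_ext
    intro n x hx
    simp only [LinearMap.comp_apply, LinearMap.id_apply]
    rw [A.parity_of_mem (A.parity_mem hx), A.parity_of_mem hx, smul_smul, ← mul_zpow]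
    simp
  exact congrArg (fun F => F x) this

theorem GradedOHom.map_parity {A B : GradedOAlgebra O} (f : GradedOHom A B) (c : C)
    (x : A.carrier c) : f.toFun c (A.parity c x) = B.parity c (f.toFun c x) := by
  have : f.toFun c ∘ₗ A.parity c = B.parity c ∘ₗ f.toFun c := by
    apply A.linearMap_ext
    intro n x hx
    simp only [LinearMap.comp_apply]
    rw [A.parity_of_mem hx, B.parity_of_mem (f.map_gr c n x hx), map_smul]
  exact congrArg (fun F => F x) this

theorem DGOAlgebra.parity_d (A : DGOAlgebra O) {c : C} (x : A.carrier c) :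
    A.parity c (A.d c x) = -A.d c (A.parity c x) := by
  rw [A.parity_comm (-1) (fun n x hx => A.d_mem c n x hx)]
  simp

/-- Auxiliary: the map applied to the `j`-th factor when the `i`-th one is differentiated. -/
noncomputable def DGOAlgebra.dFactor (A : DGOAlgebra O) {I : Type} [LinearOrder I]
    (a : I → C) (i j : I) : A.carrier (a j) →ₗ[k] A.carrier (a j) :=
  if j < i then A.parity (a j) else if j = i then A.d (a j) else LinearMap.id

/-- The Leibniz rule for elements that need not be homogeneous. -/
theorem DGOAlgebra.d_act_eq_sum (A : DGOAlgebra O) {I : Type} [Fintype I] [LinearOrder I]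
    {a : I → C} {c : C} (o : O.Op a c) (x : ∀ i, A.carrier (a i)) :
    A.d c (A.act o x) = ∑ i, A.act o (fun j => A.dFactor a i j (x j)) := by
  have : (A.d c).compMultilinearMap (A.act o) =
      ∑ i, (A.act o).compLinearMap (A.dFactor a i) := by
    apply A.multilinearMap_ext
    intro n x hx
    simp only [LinearMap.compMultilinearMap_apply, MultilinearMap.compLinearMap_apply,
      _root_.sum_apply]
    rw [A.d_act o n x hx]
    refine Finset.sum_congr rfl fun i _ => ?_
    -- The Koszul sign of the `i`-th term is a product of one sign per factor to the left of `i`, so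
    -- it can be absorbed into parity operators on those factors.
    have h : (fun j => A.dFactor a i j (x j)) = fun j => (if j < i then (-1 : k) ^ n j else 1) •
        Function.update x i (A.d (a i) (x i)) j := by
      funext j
      rcases lt_trichotomy j i with h | h | h
      · simp [dFactor, h, h.ne, A.parity_of_mem (hx j)]
      · subst h
        simp [dFactor]
      · simp [dFactor, h.not_gt, h.ne']
    rw [h, MultilinearMap.map_smul_univ, zpow_neg_one_sum, Finset.prod_filter]
  simpa [_root_.sum_apply] using congrArg (fun F => F x) this

/-- Both sides expand by the Leibniz rule into terms where each input is hit by the parity operator,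
the differential or the identity; `f` commutes with all three there. So commuting with `d`
propagates from the inputs of an operation to its output, and for free algebras only generators need
checking. -/
theorem GradedOHom.map_d_act {A B : DGOAlgebra O}
    (f : GradedOHom A.toGradedOAlgebra B.toGradedOAlgebra)
    {I : Type} [Fintype I] [LinearOrder I] {a : I → C} {c : C} (o : O.Op a c)
    (x : ∀ i, A.carrier (a i)) (h : ∀ i, f.toFun (a i) (A.d _ (x i)) = B.d _ (f.toFun _ (x i))) :
    f.toFun c (A.d c (A.act o x)) = B.d c (f.toFun c (A.act o x)) := by
  rw [f.map_act, A.d_act_eq_sum, B.d_act_eq_sum, map_sum]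
  refine Finset.sum_congr rfl fun i _ => ?_
  rw [f.map_act]
  congr 1
  funext j
  simp only [DGOAlgebra.dFactor]
  split_ifs with h1 h2
  · exact f.map_parity _ _
  · exact h j
  · rfl

end Components

/-! ### Equality and composition of maps. -/

section Homs

variable {k : Type u} [Field k] {C : Type u} {O : ColoredOperad k C}

theorem GradedOHom.ext_toFun {A B : GradedOAlgebra O} {f g : GradedOHom A B}
    (h : ∀ c x, f.toFun c x = g.toFun c x) : f = g := by
  cases f
  cases g
  congr
  funext c
  exact LinearMap.ext (h c)

theorem DGOHom.ext_toFun {A B : DGOAlgebra O} {f g : DGOHom A B}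
    (h : ∀ c x, f.toFun c x = g.toFun c x) : f = g := by
  have := GradedOHom.ext_toFun h
  cases f
  cases g
  congr

/-- The identity of a graded algebra over `O`. -/
def GradedOHom.id (A : GradedOAlgebra O) : GradedOHom A A where
  toFun _ := LinearMap.id
  map_gr _ _ _ hx := hx
  map_act _ _ := rfl

/-- Composition of maps of graded algebras over `O` (first `f`, then `g`). -/
def GradedOHom.comp {A B D : GradedOAlgebra O} (g : GradedOHom B D) (f : GradedOHom A B) :
    GradedOHom A D where
  toFun c := g.toFun c ∘ₗ f.toFun c
  map_gr c n x hx := g.map_gr c n _ (f.map_gr c n x hx)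
  map_act o x := by simp [f.map_act, g.map_act]

end Homs

/-! ### Graded subalgebras, induction on free algebras, equalizers. -/

section Sub

variable {k : Type u} [Field k] {C : Type u} {O : ColoredOperad k C}

/-- The graded subalgebra on a family of graded subspaces that is closed under the operations. -/
def GradedOAlgebra.sub (A : GradedOAlgebra O) (S : ∀ c, Submodule k (A.carrier c))
    (hgr : ∀ c, ∀ x ∈ S c, ∀ n, A.proj c n x ∈ S c)
    (hact : ∀ {I : Type} [Fintype I] [LinearOrder I] {a : I → C} {c : C} (o : O.Op a c)
      (x : ∀ i, A.carrier (a i)), (∀ i, x i ∈ S (a i)) → A.act o x ∈ S c) :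
    GradedOAlgebra O where
  carrier c := S c
  gr c n := (A.gr c n).comap (S c).subtype
  isInternal c := by
    have h := A.isInternal c
    rw [DirectSum.isInternal_submodule_iff_iSupIndep_and_iSup_eq_top] at h ⊢
    refine ⟨fun n => ?_, ?_⟩
    · rw [Submodule.disjoint_def]
      intro x hx hx'
      refine Subtype.ext ((Submodule.disjoint_def.1 (h.1 n)) _ hx ?_)
      have := Submodule.mem_map_of_mem (f := (S c).subtype) hx'
      simp only [Submodule.map_iSup] at this
      exact (iSup₂_mono fun m _ => Submodule.map_comap_le _ _) this
    · rw [eq_top_iff]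
      rintro ⟨x, hx⟩ -
      -- By `hgr` the homogeneous components of `x` stay in `S`, and `x` is their sum.
      have key : x ∈ (⨆ n, (A.gr c n).comap (S c).subtype).map (S c).subtype := by
        refine A.mem_of_proj_mem _ fun n => ?_
        exact ⟨⟨_, hgr c x hx n⟩, Submodule.mem_iSup_of_mem n (A.proj_mem c n x), rfl⟩
      obtain ⟨y, hy, rfl⟩ := key
      exact hy
  act {I} _ _ {a} {c} :=
    { toFun := fun o =>
        ((A.act o).compLinearMap (fun i => (S (a i)).subtype)).codRestrict (S c)
          (fun x => hact o _ fun i => (x i).2)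
      map_add' := fun o o' => by
        refine MultilinearMap.ext fun x => Subtype.ext ?_
        change A.act (o + o') (fun i => (x i : A.carrier (a i))) = A.act o _ + A.act o' _
        rw [map_add]
        rfl
      map_smul' := fun r o => by
        refine MultilinearMap.ext fun x => Subtype.ext ?_
        change A.act (r • o) (fun i => (x i : A.carrier (a i))) = r • A.act o _
        rw [map_smul]
        rfl }
  act_mem o n x hx := A.act_mem o n _ hx
  act_one c x := Subtype.ext (A.act_one c _)
  act_comp o p x := Subtype.ext (A.act_comp o p _)
  act_relabel e _ _ o n x hx := Subtype.ext (A.act_relabel e o n _ hx)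

/-- Induction on elements of a free algebra over `O`. -/
theorem GradedOAlgebra.IsFreeOn.induction {T : GradedOAlgebra O} {X : Type u} {col : X → C}
    {deg : X → ℤ} {gen : ∀ x, T.carrier (col x)} (hT : T.IsFreeOn col deg gen)
    (S : ∀ c, Submodule k (T.carrier c))
    (hgr : ∀ c, ∀ x ∈ S c, ∀ n, T.proj c n x ∈ S c)
    (hact : ∀ {I : Type} [Fintype I] [LinearOrder I] {a : I → C} {c : C} (o : O.Op a c)
      (x : ∀ i, T.carrier (a i)), (∀ i, x i ∈ S (a i)) → T.act o x ∈ S c)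
    (hgen : ∀ x, gen x ∈ S (col x)) (c : C) (x : T.carrier c) : x ∈ S c := by
  obtain ⟨φ, hφ, -⟩ := hT.existsUnique_hom (T.sub S hgr hact) (fun x => ⟨gen x, hgen x⟩)
    hT.gen_mem
  let ι : GradedOHom (T.sub S hgr hact) T :=
    { toFun := fun c => (S c).subtype
      map_gr := fun _ _ _ hx => hx
      map_act := fun _ _ => rfl }
  -- Freeness is only a universal property here. The map into the subalgebra fixing the generators
  -- becomes an endomorphism of `T` fixing the generators, hence the identity by uniqueness; so the
  -- subalgebra is everything.
  have h : ι.comp φ = GradedOHom.id T := by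
    refine (hT.existsUnique_hom T gen hT.gen_mem).unique (fun x => ?_) (fun x => rfl)
    exact congrArg Subtype.val (hφ x)
  have hx : ι.toFun c (φ.toFun c x) = x :=
    congrArg (fun f : GradedOHom T T => f.toFun c x) h
  rw [← hx]
  exact Subtype.property (p := (· ∈ S c)) _

/-- The equalizer of two maps of dg algebras over `O`. -/
def DGOAlgebra.equalizer {A D : DGOAlgebra O} (f g : DGOHom A D) : DGOAlgebra O where
  toGradedOAlgebra := A.toGradedOAlgebra.sub (fun c => LinearMap.eqLocus (f.toFun c) (g.toFun c))
    (fun c x hx n => by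
      have h : f.toFun c x = g.toFun c x := hx
      change f.toFun c _ = g.toFun c _
      rw [f.map_proj, g.map_proj, h])
    (fun o x hx => by
      have h : ∀ i, f.toFun _ (x i) = g.toFun _ (x i) := hx
      change f.toFun _ _ = g.toFun _ _
      rw [f.map_act, g.map_act]
      simp only [h])
  d c := (A.d c).restrict fun x hx => by
      have h : f.toFun c x = g.toFun c x := hx
      change f.toFun c _ = g.toFun c _
      rw [f.map_d, g.map_d, h]
  d_mem c n x hx := A.d_mem c n _ hx
  d_d c x := Subtype.ext (A.d_d c _)
  d_act {I} _ _ {a} {c} o n x hx := by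
    refine Subtype.ext ?_
    refine (A.d_act o n (fun i => (x i).1) hx).trans ?_
    refine Eq.trans ?_ (map_sum (LinearMap.eqLocus (f.toFun c) (g.toFun c)).subtype _ _).symm
    refine Finset.sum_congr rfl fun i _ => ?_
    refine congrArg (fun y => (-1 : k) ^ (∑ j with j < i, n j) • A.act o y) ?_
    funext j
    by_cases h : j = i
    · subst h
      simp only [Function.update_self]
      rfl
    · simp only [Function.update_of_ne h]
      rfl

/-- The inclusion of the equalizer. -/
def DGOAlgebra.equalizerι {A D : DGOAlgebra O} (f g : DGOHom A D) :
    DGOHom (DGOAlgebra.equalizer f g) A where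
  toFun c := (LinearMap.eqLocus (f.toFun c) (g.toFun c)).subtype
  map_gr _ _ _ hx := hx
  map_act _ _ := rfl
  map_d _ _ := rfl

/-- The map into the equalizer given by its universal property. -/
def DGOAlgebra.equalizerLift {T A D : DGOAlgebra O} {f g : DGOHom A D} (h : DGOHom T A)
    (w : f.comp h = g.comp h) : DGOHom T (DGOAlgebra.equalizer f g) where
  toFun c := (h.toFun c).codRestrict (LinearMap.eqLocus (f.toFun c) (g.toFun c))
    fun x => congrArg (fun F : DGOHom T D => F.toFun c x) w
  map_gr c n x hx := h.map_gr c n x hx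
  map_act o x := Subtype.ext (h.map_act o x)
  map_d c x := Subtype.ext (h.map_d c x)

end Sub

/-! ### Products of dg algebras. -/

section Prod

variable {k : Type u} [Field k] {C : Type u} {O : ColoredOperad k C}

theorem isInternal_prod {M N : Type*} [AddCommGroup M] [Module k M] [AddCommGroup N] [Module k N]
    (G : ℤ → Submodule k M) (G' : ℤ → Submodule k N) (hG : DirectSum.IsInternal G)
    (hG' : DirectSum.IsInternal G') : DirectSum.IsInternal (fun n => (G n).prod (G' n)) := by
  rw [DirectSum.isInternal_submodule_iff_iSupIndep_and_iSup_eq_top] at hG hG' ⊢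
  constructor
  · intro n
    rw [Submodule.disjoint_def]
    intro x hx hx'
    have h1 : x.1 ∈ ⨆ m, ⨆ (_ : m ≠ n), G m := by
      have := Submodule.mem_map_of_mem (f := LinearMap.fst k M N) hx'
      simp only [Submodule.map_iSup] at this
      refine (iSup₂_mono (fun m hm => ?_) : _ ≤ ⨆ m, ⨆ (_ : m ≠ n), G m) this
      rintro _ ⟨y, hy, rfl⟩
      exact hy.1
    have h2 : x.2 ∈ ⨆ m, ⨆ (_ : m ≠ n), G' m := by
      have := Submodule.mem_map_of_mem (f := LinearMap.snd k M N) hx'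
      simp only [Submodule.map_iSup] at this
      refine (iSup₂_mono (fun m hm => ?_) : _ ≤ ⨆ m, ⨆ (_ : m ≠ n), G' m) this
      rintro _ ⟨y, hy, rfl⟩
      exact hy.2
    exact Prod.ext ((Submodule.disjoint_def.1 (hG.1 n)) _ hx.1 h1)
      ((Submodule.disjoint_def.1 (hG'.1 n)) _ hx.2 h2)
  · rw [eq_top_iff]
    rintro ⟨x, y⟩ -
    have hx : (x, (0 : N)) ∈ ⨆ n, (G n).prod (G' n) := by
      have h : x ∈ ⨆ n, G n := by rw [hG.2]; trivial
      have := Submodule.mem_map_of_mem (f := LinearMap.inl k M N) h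
      simp only [Submodule.map_iSup] at this
      refine (iSup_mono (fun m => ?_) : _ ≤ ⨆ n, (G n).prod (G' n)) this
      rintro _ ⟨y, hy, rfl⟩
      exact ⟨hy, Submodule.zero_mem _⟩
    have hy : ((0 : M), y) ∈ ⨆ n, (G n).prod (G' n) := by
      have h : y ∈ ⨆ n, G' n := by rw [hG'.2]; trivial
      have := Submodule.mem_map_of_mem (f := LinearMap.inr k M N) h
      simp only [Submodule.map_iSup] at this
      refine (iSup_mono (fun m => ?_) : _ ≤ ⨆ n, (G n).prod (G' n)) this
      rintro _ ⟨z, hz, rfl⟩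
      exact ⟨Submodule.zero_mem _, hz⟩
    simpa using Submodule.add_mem _ hx hy

/-- The product of two dg algebras over `O`. -/
def DGOAlgebra.prod (A B : DGOAlgebra O) : DGOAlgebra O where
  carrier c := A.carrier c × B.carrier c
  gr c n := (A.gr c n).prod (B.gr c n)
  isInternal c := isInternal_prod _ _ (A.isInternal c) (B.isInternal c)
  act {I} _ _ {a} {c} :=
    { toFun := fun o => ((A.act o).compLinearMap (fun _ => LinearMap.fst k _ _)).prod
        ((B.act o).compLinearMap (fun _ => LinearMap.snd k _ _))
      map_add' := fun o o' => by
        refine MultilinearMap.ext fun x => Prod.ext ?_ ?_ <;> simp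
      map_smul' := fun r o => by
        refine MultilinearMap.ext fun x => Prod.ext ?_ ?_ <;> simp }
  act_mem o n x hx := ⟨A.act_mem o n _ fun i => (hx i).1, B.act_mem o n _ fun i => (hx i).2⟩
  act_one c x := Prod.ext (A.act_one c _) (B.act_one c _)
  act_comp o p x := Prod.ext (A.act_comp o p _) (B.act_comp o p _)
  act_relabel e _ _ o n x hx := Prod.ext (A.act_relabel e o n _ fun j => (hx j).1)
    (B.act_relabel e o n _ fun j => (hx j).2)
  d c := (A.d c).prodMap (B.d c)
  d_mem c n x hx := ⟨A.d_mem c n _ hx.1, B.d_mem c n _ hx.2⟩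
  d_d c x := Prod.ext (A.d_d c _) (B.d_d c _)
  d_act {I} _ _ {a} {c} o n x hx := by
    refine Prod.ext ?_ ?_
    · refine (A.d_act o n (fun i => (x i).1) fun i => (hx i).1).trans ?_
      rw [Prod.fst_sum]
      refine Finset.sum_congr rfl fun i _ => ?_
      refine congrArg (fun y => (-1 : k) ^ (∑ j with j < i, n j) • A.act o y) ?_
      funext j
      by_cases h : j = i
      · subst h; simp
      · simp [h]
    · refine (B.d_act o n (fun i => (x i).2) fun i => (hx i).2).trans ?_
      rw [Prod.snd_sum]
      refine Finset.sum_congr rfl fun i _ => ?_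
      refine congrArg (fun y => (-1 : k) ^ (∑ j with j < i, n j) • B.act o y) ?_
      funext j
      by_cases h : j = i
      · subst h; simp
      · simp [h]

/-- The first projection. -/
def DGOAlgebra.fst (A B : DGOAlgebra O) : DGOHom (A.prod B) A where
  toFun c := LinearMap.fst k (A.carrier c) (B.carrier c)
  map_gr _ _ _ hx := hx.1
  map_act _ _ := rfl
  map_d _ _ := rfl

/-- The second projection. -/
def DGOAlgebra.snd (A B : DGOAlgebra O) : DGOHom (A.prod B) B where
  toFun c := LinearMap.snd k (A.carrier c) (B.carrier c)
  map_gr _ _ _ hx := hx.2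
  map_act _ _ := rfl
  map_d _ _ := rfl

/-- The map into a product with given components. -/
def DGOHom.pair {T A B : DGOAlgebra O} (f : DGOHom T A) (g : DGOHom T B) :
    DGOHom T (A.prod B) where
  toFun c := (f.toFun c).prod (g.toFun c)
  map_gr c n x hx := ⟨f.map_gr c n x hx, g.map_gr c n x hx⟩
  map_act o x := Prod.ext (f.map_act o x) (g.map_act o x)
  map_d c x := Prod.ext (f.map_d c x) (g.map_d c x)

end Prod

/-! ### Surjections with acyclic kernel and the lifting property. -/

section Lifting

variable {k : Type u} [Field k] {C : Type u} {O : ColoredOperad k C}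

/-- The map is surjective and its kernel is acyclic (in every colour). -/
structure DGOHom.IsAcyclicFibration {E D : DGOAlgebra O} (q : DGOHom E D) : Prop where
  surjective : ∀ c, Function.Surjective (q.toFun c)
  exists_of_mem_ker : ∀ c (x : E.carrier c), q.toFun c x = 0 → E.d c x = 0 →
    ∃ y, q.toFun c y = 0 ∧ E.d c y = x

/-- For any preimage `w` of `t`, the defect `z - d w` is a cycle in the kernel of `q`, hence `d v`
with `v` in the kernel, and `w + v` solves both equations. This is the inductive step of the lifting
argument. -/
theorem DGOHom.IsAcyclicFibration.exists_lift_elem {E D : DGOAlgebra O} {q : DGOHom E D}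
    (hq : q.IsAcyclicFibration) {c : C} {n : ℤ} {z : E.carrier c} (hz : z ∈ E.gr c (n - 1))
    (hdz : E.d c z = 0) {t : D.carrier c} (ht : t ∈ D.gr c n)
    (h : q.toFun c z = D.d c t) :
    ∃ w ∈ E.gr c n, q.toFun c w = t ∧ E.d c w = z := by
  obtain ⟨w, hw⟩ := hq.surjective c t
  obtain ⟨v, hv, hdv⟩ := hq.exists_of_mem_ker c (z - E.d c w)
    (by rw [map_sub, q.map_d, hw, h, sub_self]) (by rw [map_sub, E.d_d, hdz, sub_self])
  -- Neither `w` nor `v` need be homogeneous. Since `t` and `z` are, the component of degree `n`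
  -- satisfies the same two equations.
  refine ⟨E.proj c n (w + v), E.proj_mem c n _, ?_, ?_⟩
  · rw [q.map_proj, map_add, hw, hv, add_zero, D.proj_of_mem ht, if_pos rfl]
  · rw [E.d_proj, map_add, hdv, add_sub_cancel, E.proj_of_mem hz, if_pos rfl]

/-- Free triangular dg algebras over `O` have the left lifting property against surjections with
acyclic kernel. -/
theorem DGOAlgebra.IsFreeTriangular.exists_lift {T E D : DGOAlgebra O} (hT : T.IsFreeTriangular)
    {q : DGOHom E D} (hq : q.IsAcyclicFibration) (f : DGOHom T D) :
    ∃ g : DGOHom T E, q.comp g = f := by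
  classical
  obtain ⟨X, col, deg, gen, hfree, _, hwf, hd⟩ := hT
  have hext : ∀ e : ∀ x, E.gr (col x) (deg x), ∃ φ : GradedOHom T.toGradedOAlgebra
      E.toGradedOAlgebra, ∀ x, φ.toFun (col x) (gen x) = e x := fun e =>
    (hfree.existsUnique_hom E.toGradedOAlgebra (fun x => e x) fun x => (e x).2).exists
  choose ext hext using hext
  -- Triangularity: the image of `d (gen x)` depends only on the values chosen below `x`.
  have hcongr : ∀ (e e' : ∀ x, E.gr (col x) (deg x)) x, (∀ y, y < x → e y = e' y) →
      (ext e).toFun _ (T.d _ (gen x)) = (ext e').toFun _ (T.d _ (gen x)) := by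
    intro e e' x h
    refine LinearMap.eqOn_span (f := (ext e).toFun _) (g := (ext e').toFun _) ?_ (hd x)
    rintro _ ⟨m, y, o, hy, rfl⟩
    rw [GradedOHom.map_act, GradedOHom.map_act]
    congr 1
    funext i
    rw [hext, hext, h _ (hy i)]
  have step : ∀ (e : ∀ x, E.gr (col x) (deg x)) x,
      (∀ y, y < x → q.toFun _ (e y : E.carrier (col y)) = f.toFun _ (gen y) ∧
        E.d _ (e y : E.carrier (col y)) = (ext e).toFun _ (T.d _ (gen y))) →
      ∃ w : E.gr (col x) (deg x), q.toFun _ (w : E.carrier (col x)) = f.toFun _ (gen x) ∧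
        E.d _ (w : E.carrier (col x)) = (ext e).toFun _ (T.d _ (gen x)) := by
    intro e x h
    have h1 : q.toFun _ ((ext e).toFun _ (T.d _ (gen x))) = f.toFun _ (T.d _ (gen x)) := by
      refine LinearMap.eqOn_span (f := q.toFun _ ∘ₗ (ext e).toFun _) (g := f.toFun _) ?_ (hd x)
      rintro _ ⟨m, y, o, hy, rfl⟩
      rw [LinearMap.comp_apply, GradedOHom.map_act, q.map_act, f.map_act]
      congr 1
      funext i
      rw [hext, (h _ (hy i)).1]
    -- The map `ext e` commutes with `d` on the smaller generators, hence on operations applied to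
    -- them, hence on `d (gen x)`. As `d ∘ d = 0`, the prescribed differential of the new value is a
    -- cycle.
    have h2 : (ext e).toFun _ (T.d _ (T.d _ (gen x))) =
        E.d _ ((ext e).toFun _ (T.d _ (gen x))) := by
      refine LinearMap.eqOn_span (f := (ext e).toFun _ ∘ₗ T.d _) (g := E.d _ ∘ₗ (ext e).toFun _)
        ?_ (hd x)
      rintro _ ⟨m, y, o, hy, rfl⟩
      refine (ext e).map_d_act o _ fun i => ?_
      rw [hext, (h _ (hy i)).2]
    rw [T.d_d, map_zero] at h2
    obtain ⟨w, hw, hqw, hdw⟩ := hq.exists_lift_elem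
      ((ext e).map_gr _ _ _ (T.d_mem _ _ _ (hfree.gen_mem x))) h2.symm
      (f.map_gr _ _ _ (hfree.gen_mem x)) (h1.trans (f.map_d _ _))
    exact ⟨⟨w, hw⟩, hqw, hdw⟩
  -- `ext` needs a value on every generator. The zeros outside the part below `x` are harmless,
  -- because by `hcongr` they do not affect the image of `d (gen x)`.
  let trunc (x : X) (e : ∀ y, y < x → E.gr (col y) (deg y)) (y : X) : E.gr (col y) (deg y) :=
    if h : y < x then e y h else 0
  let good (x : X) (e : ∀ y, E.gr (col y) (deg y)) (w : E.gr (col x) (deg x)) : Prop :=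
    q.toFun _ (w : E.carrier (col x)) = f.toFun _ (gen x) ∧
      E.d _ (w : E.carrier (col x)) = (ext e).toFun _ (T.d _ (gen x))
  -- The default `0` lets the recursion run without carrying the correctness of earlier choices;
  -- `he` shows afterwards that it is never taken.
  let F (x : X) (e : ∀ y, y < x → E.gr (col y) (deg y)) : E.gr (col x) (deg x) :=
    if h : ∃ w, good x (trunc x e) w then h.choose else 0
  let e : ∀ x, E.gr (col x) (deg x) := hwf.wf.fix F
  have he : ∀ x, good x e (e x) := by
    intro x
    induction x using hwf.wf.induction with
    | _ x ih =>
      have ht : (ext e).toFun _ (T.d _ (gen x)) =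
          (ext (trunc x fun y _ => e y)).toFun _ (T.d _ (gen x)) :=
        hcongr _ _ x fun y hy => by simp [trunc, hy]
      obtain ⟨w, hw⟩ := step e x ih
      have hex : ∃ w, good x (trunc x fun y _ => e y) w := ⟨w, hw.1, hw.2.trans ht⟩
      have hx : e x = hex.choose := (hwf.wf.fix_eq F x).trans (dif_pos hex)
      have := hex.choose_spec
      rw [← hx] at this
      exact ⟨this.1, this.2.trans ht.symm⟩
  have hcomm : ∀ c x, (ext e).toFun c (T.d c x) = E.d c ((ext e).toFun c x) := by
    refine hfree.induction
      (fun c => LinearMap.eqLocus ((ext e).toFun c ∘ₗ T.d c) (E.d c ∘ₗ (ext e).toFun c)) ?_ ?_ ?_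
    · intro c x hx n
      change (ext e).toFun c (T.d c _) = E.d c ((ext e).toFun c _)
      have hx' : (ext e).toFun c (T.d c x) = E.d c ((ext e).toFun c x) := hx
      rw [T.d_proj, GradedOHom.map_proj, GradedOHom.map_proj, E.d_proj, hx']
    · intro I _ _ a c o x hx
      exact (ext e).map_d_act o x hx
    · intro x
      change (ext e).toFun _ (T.d _ _) = E.d _ ((ext e).toFun _ _)
      rw [hext, (he x).2]
  let g : DGOHom T E := { toGradedOHom := ext e, map_d := hcomm }
  -- Two graded maps out of a free algebra that agree on generators are equal.
  have hg : (q.comp g).toGradedOHom = f.toGradedOHom := by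
    refine (hfree.existsUnique_hom D.toGradedOAlgebra (fun x => f.toFun _ (gen x))
      fun x => f.map_gr _ _ _ (hfree.gen_mem x)).unique (fun x => ?_) fun x => rfl
    change q.toFun _ ((ext e).toFun _ (gen x)) = _
    rw [hext, (he x).1]
  exact ⟨g, DGOHom.ext_toFun fun c x =>
    congrArg (fun F : GradedOHom T.toGradedOAlgebra D.toGradedOAlgebra => F.toFun c x) hg⟩

/-- Injectivity on homology, in terms of elements. -/
theorem DGOHom.IsQuasiIso.exists_of_map_eq_d {A B : DGOAlgebra O} {p : DGOHom B A}
    (hp : p.IsQuasiIso) {c : C} {b : B.carrier c} (hb : B.d c b = 0) {a : A.carrier c}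
    (h : p.toFun c b = A.d c a) : ∃ b', B.d c b' = b := by
  have h0 : p.homologyMap c (Submodule.Quotient.mk ⟨b, hb⟩) = 0 := by
    refine (Submodule.Quotient.mk_eq_zero _).2 ?_
    exact ⟨a, h.symm⟩
  have h1 := (hp c).injective (h0.trans (map_zero _).symm)
  exact (Submodule.Quotient.mk_eq_zero _).1 h1

/-- Surjectivity on homology, in terms of elements. -/
theorem DGOHom.IsQuasiIso.exists_cycle {A B : DGOAlgebra O} {p : DGOHom B A}
    (hp : p.IsQuasiIso) {c : C} {a : A.carrier c} (ha : A.d c a = 0) :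
    ∃ b a', B.d c b = 0 ∧ a = p.toFun c b + A.d c a' := by
  obtain ⟨y, hy⟩ := (hp c).surjective (Submodule.Quotient.mk ⟨a, ha⟩)
  obtain ⟨⟨b, hb⟩, rfl⟩ := Submodule.Quotient.mk_surjective _ y
  obtain ⟨a', ha'⟩ := (Submodule.Quotient.eq _).1 hy.symm
  exact ⟨b, a', hb, by
    have h : A.d c a' = a - p.toFun c b := ha'
    rw [h, add_sub_cancel]⟩

end Lifting

/-! ### Functoriality of the path object, and constant paths. -/

section PathFunctoriality

variable {k : Type u} [Field k] {C : Type u} {O : ColoredOperad k C}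

/-- The map `A ⊕ A dt → B ⊕ B dt` induced by a map `A → B` that commutes with differentiation with
respect to `t`. -/
noncomputable def DGOHom.adjoinDtMap {A B : DGOAlgebra O} (f : DGOHom A B)
    {D : ∀ c, A.carrier c →ₗ[k] A.carrier c} {D' : ∀ c, B.carrier c →ₗ[k] B.carrier c}
    (hDm hDd hD hDm' hDd' hD') (hf : ∀ c x, f.toFun c (D c x) = D' c (f.toFun c x)) :
    DGOHom (A.adjoinDt D hDm hDd hD) (B.adjoinDt D' hDm' hDd' hD') where
  toFun c := (f.toFun c).prodMap (f.toFun c)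
  map_gr c n x hx := ⟨f.map_gr c n _ hx.1, f.map_gr c _ _ hx.2⟩
  map_act {I} _ _ {a} {c} o x := by
    refine (congrArg ((f.toFun c).prodMap (f.toFun c)) (A.dtAct_apply o x)).trans ?_
    refine Eq.trans ?_ (B.dtAct_apply o _).symm
    refine Prod.ext (f.map_act o _) ?_
    refine (map_sum (f.toFun c) _ _).trans (Finset.sum_congr rfl fun i _ => ?_)
    rw [f.map_act]
    refine congrArg (B.act o) (funext fun j => ?_)
    simp only [GradedOAlgebra.dtFactor]
    split_ifs
    · rfl
    · rfl
    · exact f.map_parity _ _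
  map_d c x := by
    refine (congrArg ((f.toFun c).prodMap (f.toFun c)) (A.dtDiff_apply D c x)).trans ?_
    refine Eq.trans ?_ (B.dtDiff_apply D' c _).symm
    refine Prod.ext (f.map_d c _) ?_
    refine (map_add (f.toFun c) _ _).trans (congrArg₂ _ (f.map_d c _) ?_)
    exact (f.map_parity c _).trans (congrArg _ (hf c _))

/-- The differential of `A[t]`. -/
noncomputable def DGOAlgebra.polyD (A : DGOAlgebra O) (c : C) :
    (Π₀ _ : ℕ, A.carrier c) →ₗ[k] (Π₀ _ : ℕ, A.carrier c) :=
  DFinsupp.mapRange.linearMap (fun _ => A.d c)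

theorem DGOAlgebra.polyD_single (A : DGOAlgebra O) {c : C} (m : ℕ) (x : A.carrier c) :
    A.polyD c (DFinsupp.single m x) = DFinsupp.single m (A.d c x) :=
  DFinsupp.mapRange_single (hf := fun _ => map_zero _)

/-- The map `A[t] → B[t]` induced by a map `A → B`, on underlying vector spaces. -/
noncomputable def DGOHom.polyFun {A B : DGOAlgebra O} (f : DGOHom A B) (c : C) :
    (Π₀ _ : ℕ, A.carrier c) →ₗ[k] (Π₀ _ : ℕ, B.carrier c) :=
  DFinsupp.mapRange.linearMap (fun _ => f.toFun c)

theorem DGOHom.polyFun_single {A B : DGOAlgebra O} (f : DGOHom A B) {c : C} (m : ℕ)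
    (x : A.carrier c) :
    f.polyFun c (DFinsupp.single m x) = DFinsupp.single m (f.toFun c x) :=
  DFinsupp.mapRange_single (hf := fun _ => map_zero _)

variable [CharZero k]

/-- The parity operator of `A[t]`. -/
noncomputable def DGOAlgebra.polyParity (A : DGOAlgebra O) (c : C) :
    (Π₀ _ : ℕ, A.carrier c) →ₗ[k] (Π₀ _ : ℕ, A.carrier c) :=
  A.poly.parity c

theorem DGOAlgebra.polyParity_polyParity (A : DGOAlgebra O) {c : C} (x : Π₀ _ : ℕ, A.carrier c) :
    A.polyParity c (A.polyParity c x) = x :=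
  A.poly.parity_parity x

theorem DGOAlgebra.polyParity_polyD (A : DGOAlgebra O) {c : C} (x : Π₀ _ : ℕ, A.carrier c) :
    A.polyParity c (A.polyD c x) = -A.polyD c (A.polyParity c x) :=
  A.poly.parity_d x

/-- The map `A[t] → B[t]` induced by a map `A → B`. -/
noncomputable def DGOHom.polyMap {A B : DGOAlgebra O} (f : DGOHom A B) :
    DGOHom A.poly B.poly where
  toFun c := f.polyFun c
  map_gr c n x hx := mem_polySubmodule.2 fun m => f.map_gr c n _ (mem_polySubmodule.1 hx m)
  map_act {I} _ _ {a} {c} o x := by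
    -- Polynomials over an infinite field are determined by their values, and evaluation commutes
    -- with the operations and with `f`.
    apply poly_ext (k := k)
    intro s
    refine (polyEval_mapRange _ _ _).trans ?_
    refine (congrArg _ (polyEval_polyExt (A.act o) s x)).trans ?_
    refine (f.map_act o _).trans ?_
    refine Eq.trans ?_ (polyEval_polyExt (B.act o) s _).symm
    exact congrArg (B.act o) (funext fun i => (polyEval_mapRange _ _ _).symm)
  map_d c x := by
    refine DFinsupp.ext fun m => ?_
    exact f.map_d c _

theorem DGOHom.polyFun_polyParity {A B : DGOAlgebra O} (f : DGOHom A B) {c : C}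
    (x : Π₀ _ : ℕ, A.carrier c) :
    f.polyFun c (A.polyParity c x) = B.polyParity c (f.polyFun c x) :=
  f.polyMap.map_parity c x

/-- The map `A ⊗ k[t, dt] → B ⊗ k[t, dt]` induced by a map `A → B`. -/
noncomputable def DGOHom.pathMap {A B : DGOAlgebra O} (f : DGOHom A B) :
    DGOHom A.path B.path :=
  f.polyMap.adjoinDtMap _ _ _ _ _ _ fun c x => (polyDeriv_mapRange (f.toFun c) x).symm

/-- The inclusion of constants `A → A ⊗ k[t, dt]`. -/
noncomputable def DGOAlgebra.pathConst (A : DGOAlgebra O) : DGOHom A A.path where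
  toFun c := LinearMap.inl k _ _ ∘ₗ DFinsupp.lsingle (R := k) (M := fun _ : ℕ => A.carrier c) 0
  map_gr c n x hx := ⟨single_mem_polySubmodule 0 hx, Submodule.zero_mem _⟩
  map_act {I} _ _ {a} {c} o x := by
    refine Eq.trans ?_ (A.poly.dtAct_apply o _).symm
    refine Prod.ext ?_ (Finset.sum_eq_zero fun i _ => ?_).symm
    · refine ((polyExt_single (A.act o) (fun _ => 0) x).trans ?_).symm
      simp
      rfl
    -- The `i`-th term takes the `dt`-part of the `i`-th input, which is zero for a constant path.
    · refine (A.poly.act o).map_coord_zero i ?_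
      exact A.poly.dtFactor_self a i _
  map_d c x := by
    refine Prod.ext (polyD_single A 0 x).symm ?_
    have h : polyDeriv k (A.carrier c) (DFinsupp.single 0 x) = 0 := by
      rw [polyDeriv_single, Nat.cast_zero, zero_smul]
    refine Eq.trans ?_ (congrArg₂ (· + ·) (map_zero (A.polyD c)).symm
      ((map_zero (A.polyParity c)).symm.trans (congrArg (A.polyParity c) h.symm)))
    exact (add_zero (0 : Π₀ _ : ℕ, A.carrier c)).symm

/-- The element `u + v dt` of `A ⊗ k[t, dt]`. -/
def DGOAlgebra.pathMk (A : DGOAlgebra O) {c : C} (u v : Π₀ _ : ℕ, A.carrier c) :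
    A.path.carrier c :=
  ((u, v) : (Π₀ _ : ℕ, A.carrier c) × Π₀ _ : ℕ, A.carrier c)

theorem DGOAlgebra.exists_pathMk (A : DGOAlgebra O) {c : C} (x : A.path.carrier c) :
    ∃ u v, x = A.pathMk u v :=
  ⟨x.1, x.2, rfl⟩

theorem DGOAlgebra.pathMk_inj (A : DGOAlgebra O) {c : C} {u v u' v' : Π₀ _ : ℕ, A.carrier c} :
    A.pathMk u v = A.pathMk u' v' ↔ u = u' ∧ v = v' :=
  Prod.mk_inj

theorem DGOAlgebra.pathMk_zero (A : DGOAlgebra O) {c : C} :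
    A.pathMk (0 : Π₀ _ : ℕ, A.carrier c) 0 = 0 :=
  rfl

theorem DGOAlgebra.d_pathMk (A : DGOAlgebra O) {c : C} (u v : Π₀ _ : ℕ, A.carrier c) :
    A.path.d c (A.pathMk u v) =
      A.pathMk (A.polyD c u) (A.polyD c v + A.polyParity c (polyDeriv k (A.carrier c) u)) :=
  rfl

theorem DGOAlgebra.pathEval_pathMk (A : DGOAlgebra O) {c : C} (s : k)
    (u v : Π₀ _ : ℕ, A.carrier c) :
    (A.pathEval s).toFun c (A.pathMk u v) = polyEval (A.carrier c) s u :=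
  rfl

theorem DGOHom.pathMap_pathMk {A B : DGOAlgebra O} (f : DGOHom A B) {c : C}
    (u v : Π₀ _ : ℕ, A.carrier c) :
    f.pathMap.toFun c (A.pathMk u v) = B.pathMk (f.polyFun c u) (f.polyFun c v) :=
  rfl

theorem DGOAlgebra.pathConst_apply (A : DGOAlgebra O) {c : C} (x : A.carrier c) :
    A.pathConst.toFun c x = A.pathMk (DFinsupp.single 0 x) 0 :=
  rfl

theorem DGOAlgebra.pathEval_pathConst (A : DGOAlgebra O) {c : C} (s : k) (x : A.carrier c) :
    (A.pathEval s).toFun c (A.pathConst.toFun c x) = x := by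
  rw [pathConst_apply, pathEval_pathMk, polyEval_single, pow_zero, one_smul]

theorem DGOHom.pathEval_pathMap {A B : DGOAlgebra O} (f : DGOHom A B) {c : C} (s : k)
    (x : A.path.carrier c) :
    (B.pathEval s).toFun c (f.pathMap.toFun c x) = f.toFun c ((A.pathEval s).toFun c x) :=
  polyEval_mapRange _ _ _

theorem DGOHom.Homotopic.comp_left {T A B : DGOAlgebra O} {f g : DGOHom T A}
    (h : f.Homotopic g) (r : DGOHom A B) : (r.comp f).Homotopic (r.comp g) := by
  obtain ⟨H, rfl, rfl⟩ := h
  exact ⟨r.pathMap.comp H, DGOHom.ext_toFun fun c x => r.pathEval_pathMap 0 _,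
    DGOHom.ext_toFun fun c x => r.pathEval_pathMap 1 _⟩

end PathFunctoriality

/-! ### Integration of polynomial forms, and primitives of closed paths. -/

section Integration

variable {k : Type u} [Field k]

/-- The antiderivative with respect to `t`, with value `0` at `0`, of polynomials with coefficients
in `M`. -/
noncomputable def polyInt (k : Type u) [Field k] (M : Type*) [AddCommGroup M] [Module k M] :
    (Π₀ _ : ℕ, M) →ₗ[k] (Π₀ _ : ℕ, M) :=
  DFinsupp.lsum k
    (fun m => (m + 1 : k)⁻¹ • DFinsupp.lsingle (R := k) (M := fun _ : ℕ => M) (m + 1))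

theorem polyInt_single {M : Type*} [AddCommGroup M] [Module k M] (m : ℕ) (x : M) :
    polyInt k M (DFinsupp.single m x) = (m + 1 : k)⁻¹ • DFinsupp.single (m + 1) x := by
  simp [polyInt]

theorem polyInt_mapRange {M N : Type*} [AddCommGroup M] [Module k M] [AddCommGroup N]
    [Module k N] (f : M →ₗ[k] N) (x : Π₀ _ : ℕ, M) :
    polyInt k N (DFinsupp.mapRange.linearMap (fun _ => f) x) =
      DFinsupp.mapRange.linearMap (fun _ => f) (polyInt k M x) := by
  have : polyInt k N ∘ₗ DFinsupp.mapRange.linearMap (fun _ => f) =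
      DFinsupp.mapRange.linearMap (fun _ => f) ∘ₗ polyInt k M := by
    apply DFinsupp.lhom_ext
    intro m x
    simp only [LinearMap.comp_apply, DFinsupp.mapRange.linearMap_apply, DFinsupp.mapRange_single,
      polyInt_single]
    rw [← DFinsupp.single_smul, ← DFinsupp.single_smul, DFinsupp.mapRange_single, map_smul]
  exact congrArg (fun F => F x) this

theorem polyEval_zero_polyInt {M : Type*} [AddCommGroup M] [Module k M] (x : Π₀ _ : ℕ, M) :
    polyEval M (0 : k) (polyInt k M x) = 0 := by
  have : polyEval M (0 : k) ∘ₗ polyInt k M = 0 := by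
    apply DFinsupp.lhom_ext
    intro m x
    simp [polyInt_single, polyEval_single]
  exact congrArg (fun F => F x) this

/-- Characteristic 0 makes the denominators `m + 1` invertible. -/
theorem polyDeriv_polyInt [CharZero k] {M : Type*} [AddCommGroup M] [Module k M]
    (x : Π₀ _ : ℕ, M) : polyDeriv k M (polyInt k M x) = x := by
  have : polyDeriv k M ∘ₗ polyInt k M = LinearMap.id := by
    apply DFinsupp.lhom_ext
    intro m x
    have h : (m + 1 : k) ≠ 0 := by exact_mod_cast m.succ_ne_zero
    simp [polyInt_single, polyDeriv_single, h]
  exact congrArg (fun F => F x) this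

theorem polyInt_polyDeriv [CharZero k] {M : Type*} [AddCommGroup M] [Module k M]
    (x : Π₀ _ : ℕ, M) :
    polyInt k M (polyDeriv k M x) = x - DFinsupp.single 0 (polyEval M (0 : k) x) := by
  have : polyInt k M ∘ₗ polyDeriv k M =
      LinearMap.id - DFinsupp.lsingle (R := k) (M := fun _ : ℕ => M) 0 ∘ₗ polyEval M (0 : k) := by
    apply DFinsupp.lhom_ext
    intro m x
    rcases m with _ | m
    · simp [polyDeriv_single, polyEval_single]
    · have h : (m + 1 : k) ≠ 0 := by exact_mod_cast m.succ_ne_zero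
      simp [polyInt_single, polyDeriv_single, polyEval_single, h]
  exact congrArg (fun F => F x) this

variable [CharZero k] {C : Type u} {O : ColoredOperad k C}

/-- The integral from `0` to `1` of the `dt`-part `v dt`, with the sign that comes from moving `dt`
to the left. -/
noncomputable def DGOAlgebra.integral (A : DGOAlgebra O) {c : C} (v : Π₀ _ : ℕ, A.carrier c) :
    A.carrier c :=
  polyEval (A.carrier c) (1 : k) (polyInt k (A.carrier c) (A.polyParity c v))

/-- The `dt`-part of closedness says that `d v` and `u'` cancel up to parity. As parity anticommutes
with `d`, this means that `d` of the parity twist of `v` is `u'`. Integration commutes with `d`, and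
the integral of `u'` is `u - u(0)`. -/
theorem DGOAlgebra.polyD_polyInt_of_d_eq_zero (A : DGOAlgebra O) {c : C}
    {u v : Π₀ _ : ℕ, A.carrier c} (h : A.path.d c (A.pathMk u v) = 0) :
    A.polyD c (polyInt k (A.carrier c) (A.polyParity c v)) =
      u - DFinsupp.single 0 (polyEval (A.carrier c) (0 : k) u) := by
  rw [d_pathMk, ← pathMk_zero, pathMk_inj] at h
  have h1 : A.polyD c (A.polyParity c v) = polyDeriv k (A.carrier c) u := by
    rw [← neg_neg (A.polyD c _), ← A.polyParity_polyD, eq_neg_of_add_eq_zero_left h.2, map_neg,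
      A.polyParity_polyParity, neg_neg]
  rw [← polyInt_polyDeriv, ← h1]
  exact (polyInt_mapRange (A.d c) _).symm

/-- Stokes' theorem on the interval: the preceding identity at `t = 1`. -/
theorem DGOAlgebra.d_integral (A : DGOAlgebra O) {c : C}
    {u v : Π₀ _ : ℕ, A.carrier c} (h : A.path.d c (A.pathMk u v) = 0) :
    A.d c (A.integral v) =
      polyEval (A.carrier c) (1 : k) u - polyEval (A.carrier c) (0 : k) u := by
  refine (polyEval_mapRange (A.d c) _ _).symm.trans ?_
  refine (congrArg (polyEval (A.carrier c) (1 : k)) (A.polyD_polyInt_of_d_eq_zero h)).trans ?_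
  rw [map_sub, polyEval_single, one_pow, one_smul]

theorem DGOHom.map_integral {A B : DGOAlgebra O} (f : DGOHom A B) {c : C}
    (v : Π₀ _ : ℕ, A.carrier c) :
    f.toFun c (A.integral v) = B.integral (f.polyFun c v) := by
  refine (polyEval_mapRange (f.toFun c) _ _).symm.trans (congrArg _ ?_)
  exact (polyInt_mapRange (f.toFun c) _).symm.trans (congrArg _ (f.polyFun_polyParity v))

/-- A primitive of the cycle `u + v dt` of `A ⊗ k[t, dt]`, given a primitive `b` of `u(0)`. -/
noncomputable def DGOAlgebra.pathPrimitive (A : DGOAlgebra O) {c : C} (v : Π₀ _ : ℕ, A.carrier c)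
    (b y : A.carrier c) : A.path.carrier c :=
  A.pathMk (DFinsupp.single 0 b + polyInt k (A.carrier c) (A.polyParity c v) +
    DFinsupp.single 1 (A.d c y)) (A.polyParity c (DFinsupp.single 0 y))

theorem DGOAlgebra.pathEval_zero_pathPrimitive (A : DGOAlgebra O) {c : C}
    (v : Π₀ _ : ℕ, A.carrier c) (b y : A.carrier c) :
    (A.pathEval 0).toFun c (A.pathPrimitive v b y) = b := by
  rw [pathPrimitive, pathEval_pathMk, map_add, map_add, polyEval_zero_polyInt, polyEval_single,
    polyEval_single]
  simp

/-- The free parameter `y` moves the endpoint by an arbitrary boundary; the applications use it to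
make the endpoint vanish. -/
theorem DGOAlgebra.pathEval_one_pathPrimitive (A : DGOAlgebra O) {c : C}
    (v : Π₀ _ : ℕ, A.carrier c) (b y : A.carrier c) :
    (A.pathEval 1).toFun c (A.pathPrimitive v b y) = b + A.integral v + A.d c y := by
  rw [pathPrimitive, pathEval_pathMk, map_add, map_add, polyEval_single, polyEval_single, integral]
  simp

/-- The terms in `y` add up to `d (t y) = t d y ± y dt`, so they do not change the differential. The
remaining part `b + ∫₀ᵗ v` has `t`-derivative accounting for `v dt`, and its internal differential
is `u(0) + (u - u(0))`. -/
theorem DGOAlgebra.d_pathPrimitive (A : DGOAlgebra O) {c : C} {u v : Π₀ _ : ℕ, A.carrier c}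
    (h : A.path.d c (A.pathMk u v) = 0) {b : A.carrier c}
    (hb : A.d c b = polyEval (A.carrier c) (0 : k) u) (y : A.carrier c) :
    A.path.d c (A.pathPrimitive v b y) = A.pathMk u v := by
  rw [pathPrimitive, d_pathMk, pathMk_inj]
  constructor
  · rw [map_add, map_add, A.polyD_polyInt_of_d_eq_zero h, polyD_single, polyD_single, hb, A.d_d]
    simp
  · have h1 : polyDeriv k (A.carrier c) (DFinsupp.single 0 b +
        polyInt k (A.carrier c) (A.polyParity c v) + DFinsupp.single 1 (A.d c y)) =
        A.polyParity c v + A.polyD c (DFinsupp.single 0 y) := by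
      rw [map_add, map_add, polyDeriv_polyInt, polyDeriv_single, polyDeriv_single, polyD_single]
      simp
    rw [h1, map_add, A.polyParity_polyParity, A.polyParity_polyD]
    abel

theorem DGOHom.pathMap_pathPrimitive {A B : DGOAlgebra O} (f : DGOHom A B) {c : C}
    (v : Π₀ _ : ℕ, A.carrier c) (b y : A.carrier c) :
    f.pathMap.toFun c (A.pathPrimitive v b y) =
      B.pathPrimitive (f.polyFun c v) (f.toFun c b) (f.toFun c y) := by
  have h : f.polyFun c (polyInt k (A.carrier c) (A.polyParity c v)) =
      polyInt k (B.carrier c) (B.polyParity c (f.polyFun c v)) :=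
    (polyInt_mapRange (f.toFun c) _).symm.trans (congrArg _ (f.polyFun_polyParity v))
  rw [DGOAlgebra.pathPrimitive, DGOAlgebra.pathPrimitive, f.pathMap_pathMk,
    DGOAlgebra.pathMk_inj, map_add, map_add, h, f.polyFun_single, f.polyFun_single, f.map_d,
    f.polyFun_polyParity, f.polyFun_single]
  exact ⟨rfl, rfl⟩

end Integration

/-! ### The mapping path object, vertical paths, and their acyclicity. -/

section Fibrations

variable {k : Type u} [Field k] [CharZero k] {C : Type u} {O : ColoredOperad k C}

/-- The mapping path object of `p : B → A`: pairs of `b` in `B` and a path in `A` that starts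
at `p b`. -/
noncomputable def DGOHom.mappingPath {A B : DGOAlgebra O} (p : DGOHom B A) : DGOAlgebra O :=
  DGOAlgebra.equalizer (p.comp (B.fst A.path)) ((A.pathEval 0).comp (B.snd A.path))

/-- The endpoint map of the mapping path object. -/
noncomputable def DGOHom.mappingPathEnd {A B : DGOAlgebra O} (p : DGOHom B A) :
    DGOHom p.mappingPath A :=
  (A.pathEval 1).comp ((B.snd A.path).comp (DGOAlgebra.equalizerι _ _))

theorem DGOHom.IsQuasiIso.isAcyclicFibration_mappingPathEnd {A B : DGOAlgebra O} {p : DGOHom B A}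
    (hp : p.IsQuasiIso) : p.mappingPathEnd.IsAcyclicFibration where
  surjective c a := by
    -- The path `t a` runs from `0 = p 0` to `a`.
    refine ⟨⟨(0, A.pathMk (DFinsupp.single 1 a) 0), ?_⟩, ?_⟩
    · change p.toFun c 0 = (A.pathEval 0).toFun c (A.pathMk (DFinsupp.single 1 a) 0)
      rw [map_zero, A.pathEval_pathMk, polyEval_single]
      simp
    · change (A.pathEval 1).toFun c (A.pathMk (DFinsupp.single 1 a) 0) = a
      rw [A.pathEval_pathMk, polyEval_single]
      simp
  exists_of_mem_ker c := by
    rintro ⟨⟨b, η⟩, h0⟩ h1 hd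
    obtain ⟨u, v, rfl⟩ := A.exists_pathMk η
    replace h0 : p.toFun c b = polyEval (A.carrier c) (0 : k) u := h0
    replace h1 : polyEval (A.carrier c) (1 : k) u = 0 := h1
    have hdb : B.d c b = 0 := congrArg Prod.fst (congrArg Subtype.val hd)
    have hdη : A.path.d c (A.pathMk u v) = 0 := congrArg Prod.snd (congrArg Subtype.val hd)
    have hI := A.d_integral hdη
    rw [h1, zero_sub, ← h0] at hI
    -- The path ends at `0` and starts at `p b`, so `p b` bounds minus the integral, and injectivity
    -- on homology makes `b` a boundary.
    obtain ⟨b₀, hb₀⟩ := hp.exists_of_map_eq_d hdb (a := -A.integral v)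
      (by rw [map_neg, hI, neg_neg])
    -- The primitive path starting at `p b₀` would end at this cycle instead of `0`. Surjectivity on
    -- homology writes it as `p b' + d a'`; subtracting `b'` from `b₀` and taking `y = -a'` removes
    -- both terms.
    obtain ⟨b', a', hb', ha'⟩ := hp.exists_cycle (a := p.toFun c b₀ + A.integral v)
      (by rw [map_add, hI, ← p.map_d, hb₀, add_neg_cancel])
    have hb : p.toFun c (b₀ - b') + A.integral v + A.d c (-a') = 0 := by
      rw [map_sub, map_neg, ← sub_eq_zero.2 ha']
      abel
    have hdb₁ : B.d c (b₀ - b') = b := by rw [map_sub, hb', hb₀, sub_zero]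
    refine ⟨⟨(b₀ - b', A.pathPrimitive v (p.toFun c (b₀ - b')) (-a')), ?_⟩, ?_, ?_⟩
    · exact (A.pathEval_zero_pathPrimitive _ _ _).symm
    · exact (A.pathEval_one_pathPrimitive _ _ _).trans hb
    · refine Subtype.ext (Prod.ext hdb₁ ?_)
      exact A.d_pathPrimitive hdη (by rw [← p.map_d, hdb₁, h0]) _

/-- Paths in `E` that are constant after applying `q : E → A`. -/
noncomputable def DGOHom.verticalPath {E A : DGOAlgebra O} (q : DGOHom E A) : DGOAlgebra O :=
  DGOAlgebra.equalizer q.pathMap (A.pathConst.comp (q.comp (E.pathEval 0)))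

/-- The underlying path of a vertical path. -/
noncomputable def DGOHom.verticalPathι {E A : DGOAlgebra O} (q : DGOHom E A) :
    DGOHom q.verticalPath E.path :=
  DGOAlgebra.equalizerι _ _

/-- The fibre product of `q : E → A` with itself. -/
def DGOHom.kernelPair {E A : DGOAlgebra O} (q : DGOHom E A) : DGOAlgebra O :=
  DGOAlgebra.equalizer (q.comp (E.fst E)) (q.comp (E.snd E))

/-- The map that takes a vertical path to its two endpoints. -/
noncomputable def DGOHom.verticalPathEnds {E A : DGOAlgebra O} (q : DGOHom E A) :
    DGOHom q.verticalPath q.kernelPair :=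
  DGOAlgebra.equalizerLift
    (((E.pathEval 0).comp q.verticalPathι).pair ((E.pathEval 1).comp q.verticalPathι))
    (DGOHom.ext_toFun fun c x => by
      have h : q.pathMap.toFun c (q.verticalPathι.toFun c x) =
        A.pathConst.toFun c (q.toFun c ((E.pathEval 0).toFun c (q.verticalPathι.toFun c x))) := x.2
      change q.toFun c ((E.pathEval 0).toFun c (q.verticalPathι.toFun c x)) =
        q.toFun c ((E.pathEval 1).toFun c (q.verticalPathι.toFun c x))
      -- The image path in `A` is constant, so its value at `1` is its value at `0`.
      rw [← q.pathEval_pathMap 1, h, A.pathEval_pathConst])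

/-- For a closed vertical path with zero endpoints, the only obstruction to a primitive with zero
endpoints is its integral. That is a cycle in the kernel of `q`, hence a boundary there. -/
theorem DGOHom.IsAcyclicFibration.verticalPathEnds {E A : DGOAlgebra O} {q : DGOHom E A}
    (hq : q.IsAcyclicFibration) : q.verticalPathEnds.IsAcyclicFibration where
  surjective c := by
    rintro ⟨⟨e, e'⟩, he⟩
    replace he : q.toFun c e = q.toFun c e' := he
    have h0 : polyEval (E.carrier c) (0 : k)
        (DFinsupp.single 0 e + DFinsupp.single 1 (e' - e)) = e := by
      rw [map_add, polyEval_single, polyEval_single]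
      simp
    have h1 : polyEval (E.carrier c) (1 : k)
        (DFinsupp.single 0 e + DFinsupp.single 1 (e' - e)) = e' := by
      rw [map_add, polyEval_single, polyEval_single]
      simp
    -- The straight path `e + t (e' - e)` is vertical because `q e = q e'`.
    refine ⟨⟨E.pathMk (DFinsupp.single 0 e + DFinsupp.single 1 (e' - e)) 0, ?_⟩, ?_⟩
    · change q.pathMap.toFun c (E.pathMk _ _) =
        A.pathConst.toFun c (q.toFun c ((E.pathEval 0).toFun c (E.pathMk _ _)))
      rw [E.pathEval_pathMk, h0, q.pathMap_pathMk, A.pathConst_apply, A.pathMk_inj, map_zero,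
        map_add, q.polyFun_single, q.polyFun_single, map_sub, he]
      simp
    · exact Subtype.ext (Prod.ext h0 h1)
  exists_of_mem_ker c := by
    rintro ⟨η, hη⟩ hends hd
    obtain ⟨u, v, rfl⟩ := E.exists_pathMk η
    have h0 : polyEval (E.carrier c) (0 : k) u = 0 := congrArg Prod.fst (congrArg Subtype.val hends)
    have h1 : polyEval (E.carrier c) (1 : k) u = 0 := congrArg Prod.snd (congrArg Subtype.val hends)
    replace hd : E.path.d c (E.pathMk u v) = 0 := congrArg Subtype.val hd
    replace hη : q.pathMap.toFun c (E.pathMk u v) = A.pathMk (DFinsupp.single 0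
      (q.toFun c (polyEval (E.carrier c) (0 : k) u))) 0 := hη
    rw [q.pathMap_pathMk, A.pathMk_inj] at hη
    obtain ⟨y, hqy, hdy⟩ := hq.exists_of_mem_ker c (E.integral v)
      (by rw [q.map_integral, hη.2]; simp [DGOAlgebra.integral])
      (by rw [E.d_integral hd, h0, h1, sub_zero])
    -- Its endpoint is the integral minus `d y`, which is `0`. It is vertical because `q` kills `v`
    -- and `y`, so its image is the zero path.
    refine ⟨⟨E.pathPrimitive v 0 (-y), ?_⟩, ?_, ?_⟩
    · change q.pathMap.toFun c (E.pathPrimitive _ _ _) =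
        A.pathConst.toFun c (q.toFun c ((E.pathEval 0).toFun c (E.pathPrimitive _ _ _)))
      rw [E.pathEval_zero_pathPrimitive, q.pathMap_pathPrimitive, hη.2, map_zero, map_neg, hqy,
        map_zero]
      simp [DGOAlgebra.pathPrimitive, DGOAlgebra.pathMk_zero]
    · refine Subtype.ext (Prod.ext (E.pathEval_zero_pathPrimitive _ _ _) ?_)
      refine (E.pathEval_one_pathPrimitive _ _ _).trans ?_
      rw [zero_add, map_neg, hdy, add_neg_cancel]
      rfl
    · exact Subtype.ext (E.d_pathPrimitive hd (by rw [map_zero, h0]) _)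

/-- The pair `(g, g')` maps `T` to the fibre product, and a lift along the endpoint map of vertical
paths is a homotopy. -/
theorem DGOAlgebra.IsFreeTriangular.homotopic_of_comp_eq {T E A : DGOAlgebra O}
    (hT : T.IsFreeTriangular) {q : DGOHom E A} (hq : q.IsAcyclicFibration) {g g' : DGOHom T E}
    (h : q.comp g = q.comp g') : g.Homotopic g' := by
  obtain ⟨H, hH⟩ := hT.exists_lift hq.verticalPathEnds
    (DGOAlgebra.equalizerLift (f := q.comp (E.fst E)) (g := q.comp (E.snd E)) (g.pair g') h)
  refine ⟨q.verticalPathι.comp H, DGOHom.ext_toFun fun c x => ?_, DGOHom.ext_toFun fun c x => ?_⟩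
  · exact congrArg (fun F : DGOHom T q.kernelPair => (F.toFun c x).1.1) hH
  · exact congrArg (fun F : DGOHom T q.kernelPair => (F.toFun c x).1.2) hH

end Fibrations

/-! ### Existence and uniqueness of lifts up to homotopy. -/

theorem lemma2 {k : Type u} [Field k] [CharZero k] {C : Type u} (O : ColoredOperad k C)
    (T A B : DGOAlgebra O) (hT : T.IsFreeTriangular) (f : DGOHom T A)
    (p : DGOHom B A) (hp : p.IsQuasiIso) :
    (∃ g : DGOHom T B, (p.comp g).Homotopic f) ∧
      ∀ g g' : DGOHom T B, (p.comp g).Homotopic f → (p.comp g').Homotopic f →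
        g.Homotopic g' := by
  have hq := hp.isAcyclicFibration_mappingPathEnd
  constructor
  · obtain ⟨G, hG⟩ := hT.exists_lift hq f
    let ι : DGOHom p.mappingPath (B.prod A.path) := DGOAlgebra.equalizerι _ _
    refine ⟨(B.fst A.path).comp (ι.comp G), (B.snd A.path).comp (ι.comp G), ?_, hG⟩
    -- The equation defining the mapping path object says that the path component starts at `p ∘ g`;
    -- it ends at `f` by `hG`.
    exact DGOHom.ext_toFun fun c x => ((G.toFun c x).2).symm
  · rintro g g' ⟨H, hH0, hH1⟩ ⟨H', hH0', hH1'⟩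
    let G : DGOHom T p.mappingPath := DGOAlgebra.equalizerLift (g.pair H) hH0.symm
    let G' : DGOHom T p.mappingPath := DGOAlgebra.equalizerLift (g'.pair H') hH0'.symm
    -- Both homotopies end at `f`, so `G` and `G'` lift the same map.
    have h : p.mappingPathEnd.comp G = p.mappingPathEnd.comp G' := hH1.trans hH1'.symm
    exact (hT.homotopic_of_comp_eq hq h).comp_left
      ((B.fst A.path).comp (DGOAlgebra.equalizerι _ _))
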